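/- \textbf{Setting.} Let $\Omega\subset\mathbb R^2$ be a bounded domain with regular boundary, and let $\mathcal T_h$ be a decomposition $\overline\Omega=\bigcup_{K\in\mathcal T_h}K$ into finitely many (closed) simple polygons with pairwise disjoint interiors; hanging nodes are allowed. Let $h_K$ be the diameter of $K$. Fix a polygon $\hat K$ and $\gamma_1,\gamma_2,c_*,c^*>0$ and assume: $(C_0)$ each $K\in\mathcal T_h$ is the image of $\hat K$ under an affine bijection that maps the vertices of $\hat K$ onto those of $K$; $(C_1)$ each $K$ is star-shaped with respect to a disk of radius $\rho_K\ge\gamma_1h_K$; $(C_2)$ any two vertices of $K$ have distance at least $\gamma_2h_K$. The edges $e\in\mathcal E_h$ are the segments into which the sides of the elements are cut by all vertices of all elements; $\mathcal E_h^0$ is the set of the internal edges, those shared by two elements, and the other edges are the boundary edges. Put $H^m(\mathcal T_h)=\{v\in L^2(\Omega):v|_K\in H^m(K)\ \forall K\in\mathcal T_h\}$. With traces and outward unit normals $n^1,n^2$ on an internal edge shared by $K_1,K_2$, let $[v]=v^1n^1+v^2n^2$ and $\{\nabla v\}=\frac12(\nabla v^1+\nabla v^2)$; on a boundary edge let $[v]=vn$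 and $\{\nabla v\}=\nabla v$. Let $$\langle\{\nabla v\},[w]\rangle_{E}=\sum_{e\in E}\int_e\{\nabla v\}\cdot[w]\,ds\quad(E=\mathcal E_h,\mathcal E_h^0),\qquad \langle[v],[w]\rangle_{\mathcal E_h}=\sum_{e\in\mathcal E_h}\frac1{|e|}\int_e[v]\cdot[w]\,ds,$$ $$\|v\|_{1,DG}^2=\sum_K\big(\|\nabla v\|_{0,K}^2+\|v\|_{0,K}^2\big)+\langle[v],[v]\rangle_{\mathcal E_h},\qquad \|v\|_{2,DG}^2=\|v\|_{1,DG}^2+\sum_Kh_K^2|\nabla v|_{1,K}^2 .$$ Let $V_1(K)$ be the set of $v\in H^1(K)$ whose trace on $\partial K$ is continuous and affine on each side and for which $\Delta v\in\mathbb P_1(K)$. For $v\in V_1(K)$ let $\Pi^Kv\in\mathbb P_1(K)$ be given by $(\nabla\Pi^Kv,\nabla p)_{0,K}=(\nabla v,\nabla p)_{0,K}$ for all $p\in\mathbb P_1(K)$ and $\int_{\partial K}(v-\Pi^Kv)\,ds=0$. Let $W(K)=\{w\in V_1(K):(w-\Pi^Kw,q)_{0,K}=0\ \forall q\in\mathbb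 P_1(K)\}$, let $W_{DG}=\{v\in L^2(\Omega):v|_K\in W(K)\ \forall K\}$, and let $(\Pi v)|_K=\Pi^K(v|_K)$. Let $a^K(u,v)=\int_K(\nabla u\cdot\nabla v+uv)\,dx$. For each $K$ let $S^K$ be a symmetric, positive definite bilinear form such that $c_*a^K(v,v)\le S^K(v,v)\le c^*a^K(v,v)$ for all $v\in W(K)$ with $\Pi^Kv=0$. Define $$\tilde a_h(u,v)=\sum_K\Big(a^K(\Pi^Ku,\Pi^Kv)+S^K(u-\Pi^Ku,v-\Pi^Kv)\Big),$$ $$B_h(v,w)=\tilde a_h(v,w)-\langle\{\nabla\Pi v\},[w]\rangle_{\mathcal E_h^0}-\delta\langle\{\nabla\Pi w\},[v]\rangle_{\mathcal E_h^0}+\gamma\langle[v],[w]\rangle_{\mathcal E_h},\qquad\delta\in\{-1,0,1\}.$$ \textbf{Lemma.} The constants below depend only on $\hat K,\gamma_1,\gamma_2,c_*,c^*$ and on the quantities named; in particular they do not depend on $\mathcal T_h$. (i) For each $\delta\in\{-1,0,1\}$ there is $\gamma_0$ such that for each $\gamma\ge\gamma_0$ there is $M_s>0$ with $B_h(v,v)\ge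 M_s\|v\|_{1,DG}^2$ for all $v\in W_{DG}$. (ii) There is $c>0$ such that $|\tilde a_h(w,v)|\le c\|v\|_{1,DG}\|w\|_{1,DG}$ and $|\langle[v],[w]\rangle_{\mathcal E_h}|\le c\|v\|_{1,DG}\|w\|_{1,DG}$ for all $v,w\in W_{DG}$, and $|\langle\{\nabla v\},[w]\rangle_{\mathcal E_h}|\le c\|v\|_{2,DG}\|w\|_{1,DG}$ for all $v\in H^2(\mathcal T_h)$ and $w\in H^1(\mathcal T_h)$. (iii) For each $l\in\mathbb N$ there is $c>0$ such that, if $v$ is on each element a polynomial of degree at most $l$, then $|\langle\{\nabla v\},[w]\rangle_{\mathcal E_h}|\le c\|v\|_{1,DG}\|w\|_{1,DG}$ for all $w\in H^1(\mathcal T_h)$. -/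

import Mathlib

open MeasureTheory Filter Topology Set
open scoped ContDiff ENNReal BigOperators

noncomputable section

namespace DGVEM

/-- The Euclidean plane. -/
abbrev Plane : Type := EuclideanSpace ℝ (Fin 2)

/-- Arc length: the one-dimensional Hausdorff measure of the plane. -/
abbrev arc : Measure Plane := Measure.hausdorffMeasure 1

/-! ### Sobolev functions on an open set -/

/-- `g` is a square integrable weak gradient of `v` on `U`. -/
def IsWeakGrad (U : Set Plane) (v : Plane → ℝ) (g : Plane → Plane) : Prop :=
  MemLp g 2 (volume.restrict U) ∧
    ∀ φ : Plane → ℝ, ContDiff ℝ ∞ φ → HasCompactSupport φ → tsupport φ ⊆ U →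
      ∀ d : Plane, ∫ x in U, v x * fderiv ℝ φ x d = -∫ x in U, φ x * inner ℝ (g x) d

/-- `v ∈ H¹(U)`. -/
def MemH1 (U : Set Plane) (v : Plane → ℝ) : Prop :=
  MemLp v 2 (volume.restrict U) ∧ ∃ g, IsWeakGrad U v g

open Classical in
/-- The weak gradient on `U` of a function `v ∈ H¹(U)` (unique almost everywhere on `U`). -/
def wgrad (U : Set Plane) (v : Plane → ℝ) : Plane → Plane :=
  if h : ∃ g, IsWeakGrad U v g then h.choose else 0

/-- The `i`-th weak partial derivative on `U`. -/
def wpartial (U : Set Plane) (i : Fin 2) (v : Plane → ℝ) : Plane → ℝ :=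
  fun x => wgrad U v x i

/-- `v ∈ H²(U)`. -/
def MemH2 (U : Set Plane) (v : Plane → ℝ) : Prop :=
  MemH1 U v ∧ ∀ i, MemH1 U (wpartial U i v)

/-- `f` is a polynomial function of total degree at most `l`. -/
def IsPoly (l : ℕ) (f : Plane → ℝ) : Prop :=
  ∃ p : MvPolynomial (Fin 2) ℝ, p.totalDegree ≤ l ∧ ∀ x : Plane, f x = MvPolynomial.eval (⇑x) p

/-! ### Simple polygons -/

/-- A simple polygon with at least three vertices, listed in cyclic order (addition in `Fin (m + 3)`
is modulo `m + 3`); distinct sides meet only in common endpoints. The closed region `carrier` is the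
compact set with nonempty interior whose topological boundary is the closed polygonal line; by the
Jordan curve theorem it is the one enclosed by that line. -/
structure SimplePolygon where
  m : ℕ
  vertex : Fin (m + 3) → Plane
  vertex_injective : Function.Injective vertex
  simple : ∀ i j, i ≠ j →
    segment ℝ (vertex i) (vertex (i + 1)) ∩ segment ℝ (vertex j) (vertex (j + 1)) ⊆
      {vertex i, vertex (i + 1)} ∩ {vertex j, vertex (j + 1)}
  carrier : Set Plane
  isCompact_carrier : IsCompact carrier
  nonempty_interior : (interior carrier).Nonempty
  frontier_carrier : frontier carrier = ⋃ i, segment ℝ (vertex i) (vertex (i + 1))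

namespace SimplePolygon

variable (K : SimplePolygon)

/-- The `i`-th side. -/
def side (i : Fin (K.m + 3)) : Set Plane := segment ℝ (K.vertex i) (K.vertex (i + 1))

/-- The open region. -/
def region : Set Plane := interior K.carrier

/-- The boundary `∂K`. -/
def bdry : Set Plane := frontier K.carrier

/-- The diameter `h_K`. -/
def diam : ℝ := Metric.diam K.carrier

/-- `g` is the trace on `∂K` of `v ∈ H¹(K)`: the pair `(v, g)` is a limit, in
`H¹(K) × L²(∂K)`, of pairs `(φ, φ|∂K)` with `φ` smooth up to the boundary. -/
def IsTrace (v g : Plane → ℝ) : Prop :=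
  MemH1 K.region v ∧ MemLp g 2 (arc.restrict K.bdry) ∧
    ∃ φ : ℕ → Plane → ℝ, (∀ n, ContDiff ℝ ∞ (φ n)) ∧
      Tendsto (fun n => eLpNorm (fun x => φ n x - v x) 2 (volume.restrict K.region)) atTop (𝓝 0) ∧
      Tendsto (fun n => eLpNorm (fun x => gradient (φ n) x - wgrad K.region v x) 2
        (volume.restrict K.region)) atTop (𝓝 0) ∧
      Tendsto (fun n => eLpNorm (fun x => φ n x - g x) 2 (arc.restrict K.bdry)) atTop (𝓝 0)

open Classical in
/-- The trace on `∂K` of a function `v ∈ H¹(K)` (unique almost everywhere on `∂K`). -/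
def trace (v : Plane → ℝ) : Plane → ℝ :=
  if h : ∃ g, K.IsTrace v g then h.choose else 0

/-- The trace on `∂K` of the gradient of a function `v ∈ H²(K)`. -/
def gradTrace (v : Plane → ℝ) (x : Plane) : Plane :=
  WithLp.toLp 2 (fun i => K.trace (wpartial K.region i v) x)

/-- `n` is the unit normal on the segment `e` of a side of `K`, pointing out of `K`. -/
def IsOuterNormal (e : Set Plane) (n : Plane) : Prop :=
  ‖n‖ = 1 ∧ (∀ x ∈ e, ∀ y ∈ e, inner ℝ n (y - x) = 0) ∧
    ∀ x ∈ intrinsicInterior ℝ e, ∀ᶠ t : ℝ in 𝓝[>] 0, x + t • n ∉ K.carrier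

open Classical in
/-- The outward unit normal of `K` on the segment `e` of a side of `K`. -/
def normal (e : Set Plane) : Plane :=
  if h : ∃ n, K.IsOuterNormal e n then h.choose else 0

/-- The local form `a^K(u, v) = ∫_K ∇u · ∇v + u v`. -/
def a (u v : Plane → ℝ) : ℝ :=
  ∫ x in K.region, (inner ℝ (wgrad K.region u x) (wgrad K.region v x) + u x * v x)

/-- `‖v‖²_{0,K}`. -/
def sqL2 (v : Plane → ℝ) : ℝ := ∫ x in K.region, v x ^ 2

/-- `‖∇v‖²_{0,K} = |v|²_{1,K}`. -/
def sqGrad (v : Plane → ℝ) : ℝ := ∫ x in K.region, ‖wgrad K.region v x‖ ^ 2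

/-- `|∇v|²_{1,K}`. -/
def sqHess (v : Plane → ℝ) : ℝ := ∑ i, K.sqGrad (wpartial K.region i v)

/-! ### Local virtual element space of order one -/

/-- `g ∈ B₁(∂K)`: continuous on `∂K` and affine on each side. -/
def MemB1 (g : Plane → ℝ) : Prop :=
  ContinuousOn g K.bdry ∧ ∀ i, ∃ p, IsPoly 1 p ∧ EqOn g p (K.side i)

/-- `v ∈ V₁(K)`: `v ∈ H¹(K)` with trace in `B₁(∂K)` and distributional Laplacian in `P₁(K)`. -/
def MemV1 (v : Plane → ℝ) : Prop :=
  MemH1 K.region v ∧ (∃ g, K.MemB1 g ∧ K.IsTrace v g) ∧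
    ∃ q, IsPoly 1 q ∧
      ∀ φ : Plane → ℝ, ContDiff ℝ ∞ φ → HasCompactSupport φ → tsupport φ ⊆ K.region →
        ∫ x in K.region, inner ℝ (wgrad K.region v x) (gradient φ x) =
          -∫ x in K.region, q x * φ x

/-- `π` is the projection `Π^K v` of `v ∈ V₁(K)` on `P₁(K)`. -/
def IsProj (v π : Plane → ℝ) : Prop :=
  IsPoly 1 π ∧
    (∀ p, IsPoly 1 p →
      ∫ x in K.region, inner ℝ (wgrad K.region π x) (wgrad K.region p x) =
        ∫ x in K.region, inner ℝ (wgrad K.region v x) (wgrad K.region p x)) ∧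
    ∫ x in K.bdry, (K.trace v x - π x) ∂arc = 0

open Classical in
/-- The projection `Π^K v` of a function `v ∈ V₁(K)` (it exists and is unique). -/
def proj (v : Plane → ℝ) : Plane → ℝ :=
  if h : ∃ π, K.IsProj v π then h.choose else 0

/-- `w ∈ W(K)`: `w ∈ V₁(K)` and `w - Π^K w` is orthogonal to `P₁(K)` in `L²(K)`. -/
def MemW (w : Plane → ℝ) : Prop :=
  K.MemV1 w ∧ ∀ q, IsPoly 1 q → ∫ x in K.region, (w x - K.proj w x) * q x = 0

/-- `w ∈ W(K)` with `Π^K w = 0`. -/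
def MemKer (w : Plane → ℝ) : Prop := K.MemW w ∧ K.proj w = 0

/-- `S` is an admissible stabilising form on `K`: on the functions of `W(K)` annihilated by `Π^K`
it is bilinear, symmetric, positive definite and lies between `cl a^K` and `cu a^K`. -/
structure IsStab (cl cu : ℝ) (S : (Plane → ℝ) → (Plane → ℝ) → ℝ) : Prop where
  symm : ∀ u v, K.MemKer u → K.MemKer v → S u v = S v u
  linear : ∀ (s t : ℝ) (u v w), K.MemKer u → K.MemKer v → K.MemKer w →
    S (fun x => s * u x + t * v x) w = s * S u w + t * S v w
  posDef : ∀ v, K.MemKer v → ¬ v =ᵐ[volume.restrict K.region] 0 → 0 < S v v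
  lower : ∀ v, K.MemKer v → cl * K.a v v ≤ S v v
  upper : ∀ v, K.MemKer v → S v v ≤ cu * K.a v v

/-- `a_h^K(u, v) = a^K(Π^K u, Π^K v) + S^K(u - Π^K u, v - Π^K v)`. -/
def aStab (S : (Plane → ℝ) → (Plane → ℝ) → ℝ) (u v : Plane → ℝ) : ℝ :=
  K.a (K.proj u) (K.proj v) + S (fun x => u x - K.proj u x) (fun x => v x - K.proj v x)

end SimplePolygon

/-! ### Decompositions -/

/-- A bounded domain with regular boundary (of the regularity of the boundary only the
absence of slits is asked). -/
structure IsBoundedDomain (Ω : Set Plane) : Prop where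
  isOpen : IsOpen Ω
  isConnected : IsConnected Ω
  isBounded : Bornology.IsBounded Ω
  regular : interior (closure Ω) = Ω

/-- A decomposition of `Ω` into finitely many simple polygons; hanging nodes are allowed. -/
structure Decomposition (Ω : Set Plane) where
  elements : Finset SimplePolygon
  cover : closure Ω = ⋃ K ∈ elements, K.carrier
  disjoint : ∀ K ∈ elements, ∀ L ∈ elements, K ≠ L → Disjoint K.region L.region

namespace Decomposition

variable {Ω : Set Plane} (T : Decomposition Ω)

/-- Reference element: each element, with its vertices, is an affine image of `Khat`. -/
def C0 (Khat : SimplePolygon) : Prop :=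
  ∀ K ∈ T.elements, ∃ F : Plane ≃ᵃ[ℝ] Plane,
    F '' Khat.carrier = K.carrier ∧ F '' range Khat.vertex = range K.vertex

/-- Each element is star-shaped with respect to (every point of) a disk of radius
`ρ ≥ γ₁ h_K`. -/
def C1 (γ₁ : ℝ) : Prop :=
  ∀ K ∈ T.elements, ∃ (z : Plane) (ρ : ℝ), γ₁ * K.diam ≤ ρ ∧ Metric.ball z ρ ⊆ K.carrier ∧
    ∀ y ∈ Metric.ball z ρ, StarConvex ℝ y K.carrier

/-- Any two vertices of an element have distance at least `γ₂ h_K`. -/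
def C2 (γ₂ : ℝ) : Prop :=
  ∀ K ∈ T.elements, ∀ i j, i ≠ j → γ₂ * K.diam ≤ dist (K.vertex i) (K.vertex j)

/-- The nodes: all vertices of all elements. -/
def nodes : Set Plane := ⋃ K ∈ T.elements, range K.vertex

/-- Segments of the skeleton between two consecutive nodes. -/
def edgeSet : Set (Set Plane) :=
  {e | ∃ p ∈ T.nodes, ∃ q ∈ T.nodes, p ≠ q ∧ e = segment ℝ p q ∧
    (∃ K ∈ T.elements, ∃ i, e ⊆ K.side i) ∧ ∀ z ∈ T.nodes, z ∉ openSegment ℝ p q}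

theorem nodes_finite : T.nodes.Finite :=
  T.elements.finite_toSet.biUnion fun K _ => finite_range K.vertex

theorem edgeSet_finite : T.edgeSet.Finite := by
  refine ((T.nodes_finite.prod T.nodes_finite).image
    (fun r : Plane × Plane => segment ℝ r.1 r.2)).subset ?_
  rintro e ⟨p, hp, q, hq, -, rfl, -⟩
  exact ⟨(p, q), ⟨hp, hq⟩, rfl⟩

/-- The set `ℰ_h` of all edges: sides of elements, cut at every (hanging) node lying on them. -/
def edges : Finset (Set Plane) := T.edgeSet_finite.toFinset

open Classical in
/-- The elements having `e` on one of their sides (two for an internal edge, one for a boundary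
edge). -/
def adj (e : Set Plane) : Finset SimplePolygon := T.elements.filter fun K => ∃ i, e ⊆ K.side i

open Classical in
/-- The set `ℰ_h⁰` of internal edges: those shared by two elements. The other edges are the
boundary edges. -/
def innerEdges : Finset (Set Plane) := T.edges.filter fun e => (T.adj e).card = 2

/-- The jump `[v]`: `v¹ n¹ + v² n²` on an internal edge and `v n` on a boundary edge. -/
def jump (v : Plane → ℝ) (e : Set Plane) (x : Plane) : Plane :=
  ∑ K ∈ T.adj e, K.trace v x • K.normal e

/-- The average `{∇v}`: `(∇v¹ + ∇v²) / 2` on an internal edge and `∇v` on a boundary edge. -/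
def avgGrad (v : Plane → ℝ) (e : Set Plane) (x : Plane) : Plane :=
  ((T.adj e).card : ℝ)⁻¹ • ∑ K ∈ T.adj e, K.gradTrace v x

/-- `⟨{∇v}, [w]⟩` over a set `E` of edges. -/
def fluxJump (E : Finset (Set Plane)) (v w : Plane → ℝ) : ℝ :=
  ∑ e ∈ E, ∫ x in e, inner ℝ (T.avgGrad v e x) (T.jump w e x) ∂arc

/-- `⟨[v], [w]⟩` over the set of all edges, weighted by `1 / |e|`. -/
def jumpJump (v w : Plane → ℝ) : ℝ :=
  ∑ e ∈ T.edges, (1 / arc.real e) * ∫ x in e, inner ℝ (T.jump v e x) (T.jump w e x) ∂arc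

/-- `v ∈ H¹(𝒯_h)`. -/
def MemH1 (v : Plane → ℝ) : Prop :=
  MemLp v 2 (volume.restrict Ω) ∧ ∀ K ∈ T.elements, DGVEM.MemH1 K.region v

/-- `v ∈ H²(𝒯_h)`. -/
def MemH2 (v : Plane → ℝ) : Prop :=
  MemLp v 2 (volume.restrict Ω) ∧ ∀ K ∈ T.elements, DGVEM.MemH2 K.region v

/-- `v ∈ W_DG`. -/
def MemWDG (v : Plane → ℝ) : Prop :=
  MemLp v 2 (volume.restrict Ω) ∧ ∀ K ∈ T.elements, K.MemW v

/-- On each element `v` is (almost everywhere) a polynomial of degree at most `l`. -/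
def IsPiecewisePoly (l : ℕ) (v : Plane → ℝ) : Prop :=
  ∀ K ∈ T.elements, ∃ p, IsPoly l p ∧ v =ᵐ[volume.restrict K.region] p

/-- The norm `‖v‖_{1,DG}`. -/
def norm1 (v : Plane → ℝ) : ℝ :=
  √(∑ K ∈ T.elements, (K.sqGrad v + K.sqL2 v) + T.jumpJump v v)

/-- The norm `‖v‖_{2,DG}`. -/
def norm2 (v : Plane → ℝ) : ℝ :=
  √(∑ K ∈ T.elements, (K.sqGrad v + K.diam ^ 2 * K.sqHess v + K.sqL2 v) + T.jumpJump v v)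

/-- The function `Πv` that equals `Π^K v` inside each element `K`. -/
def proj (v : Plane → ℝ) (x : Plane) : ℝ :=
  ∑ K ∈ T.elements, K.region.indicator (K.proj v) x

/-- `S` assigns to each element an admissible stabilising form. -/
def IsStab (cl cu : ℝ) (S : SimplePolygon → (Plane → ℝ) → (Plane → ℝ) → ℝ) : Prop :=
  ∀ K ∈ T.elements, K.IsStab cl cu (S K)

/-- `ã_h(u, v) = ∑_K a_h^K(u, v)`. -/
def aStab (S : SimplePolygon → (Plane → ℝ) → (Plane → ℝ) → ℝ) (u v : Plane → ℝ) : ℝ :=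
  ∑ K ∈ T.elements, K.aStab (S K) u v

/-- The form `B_h`. -/
def B (S : SimplePolygon → (Plane → ℝ) → (Plane → ℝ) → ℝ) (δ γ : ℝ) (v w : Plane → ℝ) : ℝ :=
  T.aStab S v w - T.fluxJump T.innerEdges (T.proj v) w
    - δ * T.fluxJump T.innerEdges (T.proj w) v + γ * T.jumpJump v w

end Decomposition

end DGVEM

end

open DGVEM

/-!
The edge terms are controlled by a trace inequality and an inverse inequality on a single element
`K`, both with constants that depend only on its shape.

If `K` is star-shaped with respect to a disk of radius `ρ` about `z`, then the line through a side
of `K` misses the disk (`lineMap_notMem_ball`), so the triangle spanned by `z` and the side has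
height at least `ρ`. Integrating the derivative of `t² φ(z + t (x - z))²` over this triangle
bounds `h_K ‖φ‖²_{0,∂K}` by `‖φ‖²_{0,K} + h_K² ‖∇φ‖²_{0,K}` for smooth `φ`, and by density for
every function with a trace (`IsStarDisk.diam_mul_integral_trace_le`). The estimates on these
triangles are summed over the sides, as many as the reference polygon has. The same inequality
makes traces unique almost everywhere, hence linear, which the projection `Π^K` needs. Existence of
traces in `H¹(K)` is not involved: `trace` is either a trace or zero by convention, and obeys the
estimate in both cases.

Each edge `e` is at most as long as the diameter of an adjacent element, and distinct edges
overlap in a null set. Writing `1 = |e|^{1/2} |e|^{-1/2}` in the flux term and applying the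
Cauchy–Schwarz inequality twice therefore gives
`|⟨{∇v}, [w]⟩| ≤ C (∑_K ‖∇v‖²_{0,K} + h_K² |∇v|²_{1,K})^{1/2} ⟨[w], [w]⟩^{1/2}`
(`Decomposition.abs_fluxJump_le_of_shape`). For piecewise polynomials the second
derivatives are removed by an inverse inequality, which holds on the unit disk by compactness and
on `K` by scaling (`exists_sq_gradient_le`).

On `W(K)` the projection `Π^K` is orthogonal for both parts of `a^K` (`MemW.a_eq_add`), and
`v - Π^K v` lies in the kernel on which the stabilising form is equivalent to `a^K`. Hence `ã_h` is
equivalent to the broken `H¹` inner product, and Young's inequality absorbs the flux terms of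
`B_h(v, v)` into `ã_h(v, v)` and a sufficiently large penalty (`Decomposition.MemWDG.le_B`).
-/

noncomputable section

namespace DGVEM

/-! ### Weak gradients -/

theorem integrable_mul_testFun {U : Set Plane} {φ : Plane → ℝ} (hφ : Continuous φ)
    (hc : HasCompactSupport φ) {f : Plane → ℝ} (hf : MemLp f 2 (volume.restrict U)) :
    IntegrableOn (fun x => φ x * f x) U :=
  (hφ.memLp_of_hasCompactSupport (p := 2) (μ := volume.restrict U) hc).integrable_mul hf

theorem continuous_fderiv_testFun {φ : Plane → ℝ} (hφ : ContDiff ℝ ∞ φ) (d : Plane) :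
    Continuous fun x => fderiv ℝ φ x d :=
  (hφ.continuous_fderiv (by simp)).clm_apply continuous_const

theorem hasCompactSupport_fderiv_testFun {φ : Plane → ℝ} (hc : HasCompactSupport φ) (d : Plane) :
    HasCompactSupport fun x => fderiv ℝ φ x d :=
  hc.fderiv_apply (𝕜 := ℝ) d

theorem memLp_apply {μ : Measure Plane} {g : Plane → Plane} (hg : MemLp g 2 μ) (i : Fin 2) :
    MemLp (fun x => g x i) 2 μ := by
  simpa [EuclideanSpace.inner_single_right] using
    hg.inner_const (𝕜 := ℝ) (EuclideanSpace.single i (1 : ℝ))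

/-- Weak gradients on an open set are unique almost everywhere. -/
theorem IsWeakGrad.ae_eq {U : Set Plane} (hU : IsOpen U) {v : Plane → ℝ} {g k : Plane → Plane}
    (hg : IsWeakGrad U v g) (hk : IsWeakGrad U v k) : g =ᵐ[volume.restrict U] k := by
  have key : ∀ i : Fin 2, ∀ᵐ x, x ∈ U → g x i - k x i = 0 := by
    intro i
    have hm : MemLp (fun x => g x i - k x i) 2 (volume.restrict U) :=
      (memLp_apply hg.1 i).sub (memLp_apply hk.1 i)
    refine hU.ae_eq_zero_of_integral_contDiff_smul_eq_zero
      (locallyIntegrableOn_of_locallyIntegrable_restrict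
        (hm.locallyIntegrable (by norm_num))) fun φ hφ hc hs => ?_
    have h1 := hg.2 φ hφ hc hs (EuclideanSpace.single i 1)
    have h2 := hk.2 φ hφ hc hs (EuclideanSpace.single i 1)
    have h3 : ∫ x, φ x • (g x i - k x i) = ∫ x in U, φ x • (g x i - k x i) := by
      symm
      refine setIntegral_eq_integral_of_forall_compl_eq_zero fun x hx => ?_
      rw [image_eq_zero_of_notMem_tsupport fun h => hx (hs h), zero_smul]
    rw [h3]
    simp only [EuclideanSpace.inner_single_right, one_mul, conj_trivial] at h1 h2
    simp only [smul_eq_mul, mul_sub]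
    rw [integral_sub (integrable_mul_testFun hφ.continuous hc (memLp_apply hg.1 i))
      (integrable_mul_testFun hφ.continuous hc (memLp_apply hk.1 i))]
    linarith
  rw [EventuallyEq, ae_restrict_iff' hU.measurableSet]
  filter_upwards [key 0, key 1] with x h0 h1 hx
  ext i
  fin_cases i
  · exact sub_eq_zero.1 (h0 hx)
  · exact sub_eq_zero.1 (h1 hx)

theorem IsWeakGrad.linearComb {U : Set Plane} {u v : Plane → ℝ} {g k : Plane → Plane}
    (hu : MemLp u 2 (volume.restrict U)) (hv : MemLp v 2 (volume.restrict U))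
    (hg : IsWeakGrad U u g) (hk : IsWeakGrad U v k) (s t : ℝ) :
    IsWeakGrad U (fun x => s * u x + t * v x) (fun x => s • g x + t • k x) := by
  refine ⟨(hg.1.const_smul s).add (hk.1.const_smul t), fun φ hφ hc hs d => ?_⟩
  have h1 := hg.2 φ hφ hc hs d
  have h2 := hk.2 φ hφ hc hs d
  have i1 := integrable_mul_testFun (continuous_fderiv_testFun hφ d)
    (hasCompactSupport_fderiv_testFun hc d) hu
  have i2 := integrable_mul_testFun (continuous_fderiv_testFun hφ d)
    (hasCompactSupport_fderiv_testFun hc d) hv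
  have i3 := integrable_mul_testFun hφ.continuous hc (hg.1.inner_const d)
  have i4 := integrable_mul_testFun hφ.continuous hc (hk.1.inner_const d)
  have e1 : ∀ x, (s * u x + t * v x) * fderiv ℝ φ x d =
      s * (fderiv ℝ φ x d * u x) + t * (fderiv ℝ φ x d * v x) := fun x => by ring
  have e2 : ∀ x, φ x * inner ℝ (s • g x + t • k x) d =
      s * (φ x * inner ℝ (g x) d) + t * (φ x * inner ℝ (k x) d) := fun x => by
    rw [inner_add_left, real_inner_smul_left, real_inner_smul_left]; ring
  simp only [e1, e2]
  rw [integral_add (i1.const_mul s) (i2.const_mul t), integral_add (i3.const_mul s)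
    (i4.const_mul t)]
  simp only [integral_const_mul]
  simp only [mul_comm (u _), mul_comm (v _)] at h1 h2
  rw [h1, h2]; ring

theorem IsWeakGrad.congr {U : Set Plane} {u v : Plane → ℝ} {g : Plane → Plane}
    (hg : IsWeakGrad U u g) (h : u =ᵐ[volume.restrict U] v) : IsWeakGrad U v g := by
  refine ⟨hg.1, fun φ hφ hc hs d => ?_⟩
  rw [← hg.2 φ hφ hc hs d]
  refine integral_congr_ae ?_
  filter_upwards [h] with x hx
  rw [hx]

theorem isWeakGrad_wgrad {U : Set Plane} {v : Plane → ℝ} (h : ∃ g, IsWeakGrad U v g) :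
    IsWeakGrad U v (wgrad U v) := by
  rw [wgrad, dif_pos h]; exact h.choose_spec

/-- The chosen weak gradient is square integrable, also when it is zero by convention. -/
theorem memLp_wgrad (U : Set Plane) (v : Plane → ℝ) :
    MemLp (wgrad U v) 2 (volume.restrict U) := by
  by_cases h : ∃ g, IsWeakGrad U v g
  · exact (isWeakGrad_wgrad h).1
  · rw [wgrad, dif_neg h]; exact MemLp.zero

theorem wgrad_ae_eq {U : Set Plane} (hU : IsOpen U) {v : Plane → ℝ} {g : Plane → Plane}
    (hg : IsWeakGrad U v g) : wgrad U v =ᵐ[volume.restrict U] g :=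
  (isWeakGrad_wgrad ⟨g, hg⟩).ae_eq hU hg

theorem MemH1.isWeakGrad {U : Set Plane} {v : Plane → ℝ} (h : MemH1 U v) :
    IsWeakGrad U v (wgrad U v) := isWeakGrad_wgrad h.2

theorem MemH1.linearComb {U : Set Plane} {u v : Plane → ℝ} (hu : MemH1 U u) (hv : MemH1 U v)
    (s t : ℝ) : MemH1 U fun x => s * u x + t * v x :=
  ⟨(hu.1.const_mul s).add (hv.1.const_mul t), _,
    hu.isWeakGrad.linearComb hu.1 hv.1 hv.isWeakGrad s t⟩

theorem wgrad_linearComb {U : Set Plane} (hU : IsOpen U) {u v : Plane → ℝ} (hu : MemH1 U u)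
    (hv : MemH1 U v) (s t : ℝ) : wgrad U (fun x => s * u x + t * v x) =ᵐ[volume.restrict U]
      fun x => s • wgrad U u x + t • wgrad U v x :=
  wgrad_ae_eq hU (hu.isWeakGrad.linearComb hu.1 hv.1 hv.isWeakGrad s t)

theorem continuous_gradient {f : Plane → ℝ} (hf : ContDiff ℝ 1 f) : Continuous (gradient f) :=
  (InnerProductSpace.toDual ℝ Plane).symm.continuous.comp (hf.continuous_fderiv (by simp))

theorem inner_gradient (f : Plane → ℝ) (x d : Plane) :
    inner ℝ (gradient f x) d = fderiv ℝ f x d := by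
  rw [gradient, InnerProductSpace.toDual_symm_apply]

theorem gradient_linearComb {f g : Plane → ℝ} (hf : Differentiable ℝ f) (hg : Differentiable ℝ g)
    (s t : ℝ) (x : Plane) :
    gradient (fun x => s * f x + t * g x) x = s • gradient f x + t • gradient g x := by
  refine ext_inner_right ℝ fun d => ?_
  rw [inner_gradient, inner_add_left, real_inner_smul_left, real_inner_smul_left, inner_gradient,
    inner_gradient]
  have h := ((hf x).hasFDerivAt.const_mul s).add ((hg x).hasFDerivAt.const_mul t)
  have h' : HasFDerivAt (fun x => s * f x + t * g x) (s • fderiv ℝ f x + t • fderiv ℝ g x) x := h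
  rw [h'.fderiv]
  simp

theorem memLp_of_continuous_of_isBounded {E : Type*} [NormedAddCommGroup E] {f : Plane → E}
    (hf : Continuous f) {U : Set Plane} (hU : Bornology.IsBounded U) :
    MemLp f 2 (volume.restrict U) := by
  have hK : IsCompact (closure U) := hU.isCompact_closure
  have : MemLp f 2 (volume.restrict (closure U)) := by
    have : IsFiniteMeasure (volume.restrict (closure U)) :=
      ⟨by rw [Measure.restrict_apply_univ]; exact hK.measure_lt_top⟩
    obtain ⟨C, hC⟩ := (hK.image hf).isBounded.exists_norm_le
    refine MemLp.of_bound hf.aestronglyMeasurable C ?_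
    exact (ae_restrict_mem isClosed_closure.measurableSet).mono fun x hx =>
      hC _ (mem_image_of_mem f hx)
  exact this.mono_measure (Measure.restrict_mono subset_closure le_rfl)

/-- The weak gradient of a continuously differentiable function is its gradient. -/
theorem isWeakGrad_gradient {U : Set Plane} (hU : Bornology.IsBounded U)
    {f : Plane → ℝ} (hf : ContDiff ℝ 1 f) : IsWeakGrad U f (gradient f) := by
  refine ⟨memLp_of_continuous_of_isBounded (continuous_gradient hf) hU, fun φ hφ hc hs d => ?_⟩
  have e1 : ∫ x in U, f x * fderiv ℝ φ x d = ∫ x, f x * fderiv ℝ φ x d := by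
    refine setIntegral_eq_integral_of_forall_compl_eq_zero fun x hx => ?_
    have : fderiv ℝ φ x = 0 := image_eq_zero_of_notMem_tsupport (f := fderiv ℝ φ)
      fun h => hx (hs (tsupport_fderiv_subset ℝ h))
    simp [this]
  have e2 : ∫ x in U, φ x * inner ℝ (gradient f x) d = ∫ x, φ x * inner ℝ (gradient f x) d := by
    refine setIntegral_eq_integral_of_forall_compl_eq_zero fun x hx => ?_
    rw [image_eq_zero_of_notMem_tsupport fun h => hx (hs h), zero_mul]
  have hfc := hf.continuous
  have hgc : Continuous fun x => fderiv ℝ f x d :=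
    (hf.continuous_fderiv (by simp)).clm_apply continuous_const
  rw [e1, e2, integral_mul_fderiv_eq_neg_fderiv_mul_of_integrable
    (f := f) (g := φ) (v := d)]
  · simp only [inner_gradient, mul_comm (φ _)]
  · exact (hgc.mul hφ.continuous).integrable_of_hasCompactSupport hc.mul_left
  · exact (hfc.mul (continuous_fderiv_testFun hφ d)).integrable_of_hasCompactSupport
      (hasCompactSupport_fderiv_testFun hc d).mul_left
  · exact (hfc.mul hφ.continuous).integrable_of_hasCompactSupport hc.mul_left
  · exact fun x _ => (hf.differentiable (by simp)).differentiableAt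
  · exact fun x _ => (hφ.differentiable (by simp)).differentiableAt

theorem memH1_of_contDiff {U : Set Plane} (hU : Bornology.IsBounded U)
    {f : Plane → ℝ} (hf : ContDiff ℝ 1 f) : MemH1 U f :=
  ⟨memLp_of_continuous_of_isBounded hf.continuous hU, _, isWeakGrad_gradient hU hf⟩

/-! ### Polynomial functions -/

theorem hasFDerivAt_eval (p : MvPolynomial (Fin 2) ℝ) (x : Plane) :
    HasFDerivAt (fun x : Plane => MvPolynomial.eval (⇑x) p)
      (∑ i, MvPolynomial.eval (⇑x) (MvPolynomial.pderiv i p) •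
        (EuclideanSpace.proj i : Plane →L[ℝ] ℝ)) x := by
  induction p using MvPolynomial.induction_on with
  | C a => simpa using hasFDerivAt_const a x
  | add p q hp hq =>
    simp only [map_add, add_smul, Finset.sum_add_distrib]
    exact hp.add hq
  | mul_X p j hp =>
    have hj : HasFDerivAt (fun x : Plane => x j) (EuclideanSpace.proj j : Plane →L[ℝ] ℝ) x :=
      (EuclideanSpace.proj j : Plane →L[ℝ] ℝ).hasFDerivAt
    have h := hp.mul hj
    simp only [map_mul, MvPolynomial.eval_X]
    convert! h using 1
    simp only [MvPolynomial.pderiv_mul, MvPolynomial.pderiv_X, map_add, map_mul,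
      MvPolynomial.eval_X]
    refine ContinuousLinearMap.ext fun v => ?_
    rw [Fin.sum_univ_two, Fin.sum_univ_two]
    simp only [_root_.add_apply, _root_.smul_apply, PiLp.proj_apply, smul_eq_mul]
    fin_cases j <;> simp <;> ring

theorem IsPoly.contDiff {l : ℕ} {f : Plane → ℝ} (hf : IsPoly l f) {n : WithTop ℕ∞} :
    ContDiff ℝ n f := by
  obtain ⟨p, -, hp⟩ := hf
  have : f = fun x : Plane => MvPolynomial.eval (⇑x) p := funext hp
  rw [this]
  have h := AnalyticOnNhd.eval_continuousLinearMap (𝕜 := ℝ) (E := Plane)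
    (EuclideanSpace.equiv (Fin 2) ℝ).toContinuousLinearMap p
  exact (h.contDiff (n := n))

theorem gradient_eval (p : MvPolynomial (Fin 2) ℝ) (x : Plane) (i : Fin 2) :
    gradient (fun x : Plane => MvPolynomial.eval (⇑x) p) x i =
      MvPolynomial.eval (⇑x) (MvPolynomial.pderiv i p) := by
  have h := inner_gradient (fun x : Plane => MvPolynomial.eval (⇑x) p) x (EuclideanSpace.single i 1)
  rw [(hasFDerivAt_eval p x).fderiv, EuclideanSpace.inner_single_right] at h
  simp only [one_mul, conj_trivial] at h
  rw [h]
  fin_cases i <;> simp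

theorem totalDegree_pderiv_le (p : MvPolynomial (Fin 2) ℝ) (i : Fin 2) :
    (MvPolynomial.pderiv i p).totalDegree ≤ p.totalDegree - 1 := by
  refine Finset.sup_le fun m hm => ?_
  rw [MvPolynomial.mem_support_iff, MvPolynomial.coeff_pderiv] at hm
  have h := MvPolynomial.le_totalDegree (p := p)
    (MvPolynomial.mem_support_iff.2 (left_ne_zero_of_mul hm))
  rw [Finsupp.sum_add_index' (by simp) (by simp), Finsupp.sum_single_index rfl] at h
  omega

theorem IsPoly.gradient_apply {l : ℕ} {f : Plane → ℝ} (hf : IsPoly l f) (i : Fin 2) :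
    IsPoly (l - 1) fun x => gradient f x i := by
  obtain ⟨p, hl, hp⟩ := hf
  have : f = fun x : Plane => MvPolynomial.eval (⇑x) p := funext hp
  subst this
  exact ⟨_, (totalDegree_pderiv_le p i).trans (Nat.sub_le_sub_right hl 1),
    fun x => gradient_eval p x i⟩

theorem isPoly_const (l : ℕ) (c : ℝ) : IsPoly l fun _ => c := ⟨MvPolynomial.C c, by simp, by simp⟩

theorem IsPoly.linearComb {l : ℕ} {f g : Plane → ℝ} (hf : IsPoly l f) (hg : IsPoly l g)
    (s t : ℝ) : IsPoly l fun x => s * f x + t * g x := by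
  obtain ⟨p, hp, hp'⟩ := hf
  obtain ⟨q, hq, hq'⟩ := hg
  refine ⟨s • p + t • q, (MvPolynomial.totalDegree_add _ _).trans (max_le ?_ ?_), fun x => ?_⟩
  · exact (MvPolynomial.totalDegree_smul_le s p).trans hp
  · exact (MvPolynomial.totalDegree_smul_le t q).trans hq
  · simp [hp', hq']

theorem isPoly_affine (d : Plane) (c : ℝ) : IsPoly 1 fun x => inner ℝ d x + c := by
  refine ⟨MvPolynomial.C (d 0) * MvPolynomial.X 0 + MvPolynomial.C (d 1) * MvPolynomial.X 1 +
    MvPolynomial.C c, ?_, fun x => ?_⟩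
  · have h : ∀ i : Fin 2, (MvPolynomial.C (d i) * MvPolynomial.X i :
        MvPolynomial (Fin 2) ℝ).totalDegree ≤ 1 := fun i =>
      (MvPolynomial.totalDegree_mul _ _).trans (by simp)
    refine (MvPolynomial.totalDegree_add _ _).trans (max_le
      ((MvPolynomial.totalDegree_add _ _).trans (max_le (h 0) (h 1))) (by simp))
  · simp [PiLp.inner_apply, Fin.sum_univ_two, mul_comm]

theorem IsPoly.eq_const {f : Plane → ℝ} (hf : IsPoly 0 f) : ∃ c, f = fun _ => c := by
  obtain ⟨p, hl, hp⟩ := hf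
  have h := MvPolynomial.totalDegree_eq_zero_iff_eq_C.1 (Nat.le_zero.1 hl)
  exact ⟨p.coeff 0, funext fun x => by rw [hp x, h]; simp⟩

theorem gradient_affine (d : Plane) (c : ℝ) (x : Plane) :
    gradient (fun x => inner ℝ d x + c) x = d := by
  refine HasGradientAt.gradient ?_
  rw [hasGradientAt_iff_hasFDerivAt]
  exact ((innerSL ℝ d).hasFDerivAt (x := x)).add_const c

/-- Polynomial functions of degree at most one are the affine functions. -/
theorem IsPoly.eq_affine {f : Plane → ℝ} (hf : IsPoly 1 f) :
    ∃ (d : Plane) (c : ℝ), f = fun x => inner ℝ d x + c := by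
  obtain ⟨a, ha⟩ := (hf.gradient_apply 0).eq_const
  obtain ⟨b, hb⟩ := (hf.gradient_apply 1).eq_const
  have hg : ∀ x, gradient f x = !₂[a, b] := fun x => by
    ext i
    fin_cases i
    · exact congrFun ha x
    · exact congrFun hb x
  refine ⟨!₂[a, b], f 0, funext fun x => ?_⟩
  have hd : Differentiable ℝ f := (hf.contDiff (n := 1)).differentiable (by simp)
  have hd' : Differentiable ℝ fun x => f x - inner ℝ !₂[a, b] x :=
    hd.sub (innerSL ℝ !₂[a, b]).differentiable
  have h0 := is_const_of_fderiv_eq_zero hd' (fun y => by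
    ext v
    rw [show (fun x => f x - inner ℝ !₂[a, b] x) = f - (innerSL ℝ !₂[a, b]) from rfl,
      fderiv_sub hd.differentiableAt (innerSL ℝ !₂[a, b]).differentiableAt,
      ContinuousLinearMap.fderiv, _root_.sub_apply, ← inner_gradient, hg]
    simp) x 0
  simp only [inner_zero_right] at h0
  linarith

theorem IsPoly.comp_scale {l : ℕ} {f : Plane → ℝ} (hf : IsPoly l f) (z : Plane) (r : ℝ) :
    IsPoly l fun x => f (z + r • x) := by
  obtain ⟨p, hl, hp⟩ := hf
  let σ : Fin 2 → MvPolynomial (Fin 2) ℝ :=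
    fun i => MvPolynomial.C (z i) + MvPolynomial.C r * MvPolynomial.X i
  have hσ : ∀ i, (σ i).totalDegree ≤ 1 := fun i =>
    (MvPolynomial.totalDegree_add _ _).trans (max_le (by simp)
      ((MvPolynomial.totalDegree_mul _ _).trans (by simp)))
  refine ⟨MvPolynomial.bind₁ σ p, ?_, fun x => ?_⟩
  · rw [MvPolynomial.bind₁, MvPolynomial.aeval_def, MvPolynomial.eval₂_eq]
    refine (MvPolynomial.totalDegree_finsetSum _ _).trans (Finset.sup_le fun m hm => ?_)
    refine (MvPolynomial.totalDegree_mul _ _).trans ?_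
    have h1 : (∏ i ∈ m.support, σ i ^ m i).totalDegree ≤ ∑ i ∈ m.support, m i := by
      refine (MvPolynomial.totalDegree_finsetProd _ _).trans (Finset.sum_le_sum fun i _ => ?_)
      exact (MvPolynomial.totalDegree_pow _ _).trans
        ((Nat.mul_le_mul_left _ (hσ i)).trans (by simp))
    have h2 : ∑ i ∈ m.support, m i ≤ p.totalDegree := MvPolynomial.le_totalDegree hm
    have h3 : (algebraMap ℝ (MvPolynomial (Fin 2) ℝ) (p.coeff m)).totalDegree = 0 :=
      MvPolynomial.totalDegree_C _
    omega
  · simp only [hp, MvPolynomial.eval, MvPolynomial.eval₂Hom_bind₁]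
    congr 2
    ext i
    simp [σ]

/-- A polynomial vanishing on an open set is zero. -/
theorem mvPolynomial_eq_zero_of_eval_eq_zero {p : MvPolynomial (Fin 2) ℝ}
    (h : ∀ x ∈ Metric.ball (0 : Plane) 1, MvPolynomial.eval (⇑x) p = 0) : p = 0 := by
  refine MvPolynomial.funext_set (fun _ => Ioo (0 : ℝ) (1 / 2))
    (fun _ => Set.Ioo_infinite (by norm_num)) fun x hx => ?_
  rw [map_zero]
  refine h (WithLp.toLp 2 x) ?_
  have h0 := hx 0 (mem_univ _)
  have h1 := hx 1 (mem_univ _)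
  simp only [mem_Ioo] at h0 h1
  rw [mem_ball_zero_iff, ← sq_lt_one_iff₀ (norm_nonneg _), EuclideanSpace.norm_sq_eq,
    Fin.sum_univ_two]
  simp only [Real.norm_eq_abs, sq_abs]
  nlinarith

/-! ### An inverse inequality for polynomials -/

/-- A nonzero polynomial has a positive `L²` norm on the unit disk, so that compactness of the unit
sphere of coefficient vectors bounds the gradient by this norm. -/
theorem exists_norm_gradient_sq_le (l : ℕ) (R : ℝ) : ∃ C : ℝ, 0 < C ∧ ∀ f, IsPoly l f →
    ∀ x ∈ Metric.closedBall (0 : Plane) R,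
      ‖gradient f x‖ ^ 2 ≤ C * ∫ y in Metric.closedBall (0 : Plane) 1, f y ^ 2 := by
  -- `F c` and `D c` are the polynomial with coefficients `c` and its squared gradient
  let S : Finset (Fin 2 →₀ ℕ) := Finset.Iic (Finsupp.equivFunOnFinite.symm fun _ => l)
  let P : (S → ℝ) → MvPolynomial (Fin 2) ℝ := fun c => ∑ m : S, MvPolynomial.monomial m.1 (c m)
  let F : (S → ℝ) → Plane → ℝ := fun c x =>
    ∑ m : S, c m * MvPolynomial.eval (⇑x) (MvPolynomial.monomial m.1 (1 : ℝ))
  let D : (S → ℝ) → Plane → ℝ := fun c x => ∑ i : Fin 2, (∑ m : S, c m *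
    MvPolynomial.eval (⇑x) (MvPolynomial.pderiv i (MvPolynomial.monomial m.1 (1 : ℝ)))) ^ 2
  have hmon : ∀ (m : S) (a : ℝ), MvPolynomial.monomial m.1 a =
      MvPolynomial.C a * MvPolynomial.monomial m.1 (1 : ℝ) := fun m a => by
    rw [MvPolynomial.C_mul_monomial, mul_one]
  have hF : ∀ c x, F c x = MvPolynomial.eval (⇑x) (P c) := fun c x => by
    simp only [F, P, map_sum]
    exact Finset.sum_congr rfl fun m _ => by rw [hmon m (c m)]; simp
  have hD : ∀ c x, D c x = ‖gradient (F c) x‖ ^ 2 := fun c x => by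
    rw [funext (hF c), EuclideanSpace.norm_sq_eq]
    refine Finset.sum_congr rfl fun i _ => ?_
    rw [gradient_eval, Real.norm_eq_abs, sq_abs]
    simp only [P, map_sum]
    congr 1
    exact Finset.sum_congr rfl fun m _ => by
      rw [hmon m (c m), MvPolynomial.pderiv_C_mul]; simp
  have hev : ∀ q : MvPolynomial (Fin 2) ℝ, Continuous fun x : Plane => MvPolynomial.eval (⇑x) q :=
    fun q => (IsPoly.contDiff ⟨q, le_rfl, fun _ => rfl⟩ (n := 0)).continuous
  have hFc : Continuous fun y : (S → ℝ) × Plane => F y.1 y.2 :=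
    continuous_finsetSum _ fun m _ => ((continuous_apply m).comp continuous_fst).mul
      ((hev _).comp continuous_snd)
  have hDc : Continuous fun y : (S → ℝ) × Plane => D y.1 y.2 :=
    continuous_finsetSum _ fun i _ => (continuous_finsetSum _ fun m _ =>
      ((continuous_apply m).comp continuous_fst).mul ((hev _).comp continuous_snd)).pow 2
  have hsF : ∀ (t : ℝ) c x, F (t • c) x = t * F c x := fun t c x => by
    simp only [F, Finset.mul_sum, Pi.smul_apply, smul_eq_mul, mul_assoc]
  have hsD : ∀ (t : ℝ) c x, D (t • c) x = t ^ 2 * D c x := fun t c x => by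
    simp only [D, Finset.mul_sum, Pi.smul_apply, smul_eq_mul, mul_assoc, ← mul_pow]
  let Q : (S → ℝ) → ℝ := fun c => ∫ y in Metric.closedBall (0 : Plane) 1, F c y ^ 2
  have hQc : Continuous Q := continuous_parametric_integral_of_continuous
    (hFc.pow 2) (isCompact_closedBall _ _)
  have hQpos : ∀ c ∈ Metric.sphere (0 : S → ℝ) 1, 0 < Q c := by
    intro c hc
    refine lt_of_le_of_ne (integral_nonneg fun y => sq_nonneg _) fun h0 => ?_
    have hFcc : Continuous (F c) := hFc.comp (Continuous.prodMk_right c)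
    have hint : IntegrableOn (fun y => F c y ^ 2) (Metric.closedBall (0 : Plane) 1) :=
      (hFcc.pow 2).continuousOn.integrableOn_compact (isCompact_closedBall _ _)
    have hae := (setIntegral_eq_zero_iff_of_nonneg_ae (ae_of_all _ fun y => sq_nonneg (F c y))
      hint).1 h0.symm
    have hae' : (fun y => F c y ^ 2) =ᵐ[volume.restrict (Metric.ball (0 : Plane) 1)] fun _ => 0 :=
      ae_restrict_of_ae_restrict_of_subset Metric.ball_subset_closedBall hae
    have heq := Measure.eqOn_open_of_ae_eq hae' Metric.isOpen_ball (hFcc.pow 2).continuousOn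
      continuousOn_const
    have hP0 : P c = 0 := mvPolynomial_eq_zero_of_eval_eq_zero fun x hx => by
      rw [← hF]; exact pow_eq_zero_iff (two_ne_zero) |>.1 (heq hx)
    have hc0 : c = 0 := by
      funext m
      have h1 := congrArg (MvPolynomial.coeff m.1) hP0
      simp only [P, MvPolynomial.coeff_sum, MvPolynomial.coeff_monomial,
        MvPolynomial.coeff_zero] at h1
      rw [Finset.sum_eq_single m (fun b _ hb => if_neg fun h => hb (Subtype.ext h)) (by simp),
        if_pos rfl] at h1
      exact h1
    rw [hc0] at hc
    simp at hc
  obtain ⟨δ, hδ, hδQ⟩ := (isCompact_sphere (0 : S → ℝ) 1).exists_forall_le' hQc.continuousOn hQpos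
  obtain ⟨M, hM⟩ := (((isCompact_sphere (0 : S → ℝ) 1).prod
    (isCompact_closedBall (0 : Plane) R)).image hDc).isBounded.exists_norm_le
  refine ⟨(|M| + 1) / δ, by positivity, fun f hf x hx => ?_⟩
  obtain ⟨p, hl, hp⟩ := hf
  let c : S → ℝ := fun m => p.coeff m.1
  have hPc : P c = p := by
    simp only [P, c]
    rw [Finset.sum_coe_sort S (fun m => MvPolynomial.monomial m (p.coeff m))]
    conv_rhs => rw [← MvPolynomial.support_sum_monomial_coeff p]
    symm
    refine Finset.sum_subset (fun m hm => ?_) fun m _ hm => by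
      rw [MvPolynomial.notMem_support_iff.1 hm, map_zero]
    rw [Finset.mem_Iic]
    intro i
    simp only [Finsupp.equivFunOnFinite_symm_apply_apply]
    have := MvPolynomial.le_totalDegree hm
    refine le_trans ?_ (this.trans hl)
    by_cases hi : i ∈ m.support
    · exact Finset.single_le_sum (f := fun i => m i) (fun _ _ => Nat.zero_le _) hi
    · rw [Finsupp.notMem_support_iff.1 hi]; exact Nat.zero_le _
  have hfF : f = F c := funext fun y => by rw [hF, hPc, hp]
  rw [hfF, ← hD]
  change D c x ≤ (|M| + 1) / δ * Q c
  by_cases hc : c = 0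
  · have h1 : D c x = 0 := by rw [hc]; simp [D]
    rw [h1]
    exact mul_nonneg (by positivity) (integral_nonneg fun y => sq_nonneg _)
  · have hn : 0 < ‖c‖ := norm_pos_iff.2 hc
    have hu : ‖c‖⁻¹ • c ∈ Metric.sphere (0 : S → ℝ) 1 := by
      rw [mem_sphere_zero_iff_norm, norm_smul, norm_inv, norm_norm, inv_mul_cancel₀ hn.ne']
    have h1 := hδQ _ hu
    have h2 := (le_abs_self _).trans (hM _ (mem_image_of_mem _ (mk_mem_prod hu hx)))
    have hQs : Q (‖c‖⁻¹ • c) = ‖c‖⁻¹ ^ 2 * Q c := by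
      simp only [Q, hsF, mul_pow, integral_const_mul]
    simp only [hsD] at h2
    rw [hQs] at h1
    have hn2 : 0 < ‖c‖⁻¹ ^ 2 := by positivity
    have h3 : D c x * δ ≤ (|M| + 1) * Q c := by
      refine le_of_mul_le_mul_left ?_ hn2
      have hM' : M ≤ |M| + 1 := (le_abs_self M).trans (by linarith)
      have : 0 ≤ D c x := Finset.sum_nonneg fun _ _ => sq_nonneg _
      calc ‖c‖⁻¹ ^ 2 * (D c x * δ) = (‖c‖⁻¹ ^ 2 * D c x) * δ := by ring
        _ ≤ (|M| + 1) * (‖c‖⁻¹ ^ 2 * Q c) :=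
          mul_le_mul (h2.trans hM') h1 hδ.le (by positivity)
        _ = _ := by ring
    rw [div_mul_eq_mul_div, le_div_iff₀ hδ]
    exact h3

theorem gradient_comp_scale {f : Plane → ℝ} (hf : Differentiable ℝ f) (z : Plane) (r : ℝ)
    (x : Plane) : gradient (fun x => f (z + r • x)) x = r • gradient f (z + r • x) := by
  refine HasGradientAt.gradient ?_
  rw [hasGradientAt_iff_hasFDerivAt]
  have h1 : HasFDerivAt (fun x : Plane => z + r • x) (r • ContinuousLinearMap.id ℝ Plane) x :=
    ((hasFDerivAt_id x).const_smul r).const_add z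
  have h2 := (hf (z + r • x)).hasFDerivAt.comp x h1
  convert! h2 using 1
  refine ContinuousLinearMap.ext fun d => ?_
  rw [InnerProductSpace.toDual_apply_apply, real_inner_smul_left, inner_gradient]
  simp

theorem integral_closedBall_comp_scale (f : Plane → ℝ) (z : Plane) {r : ℝ} (hr : 0 < r) :
    ∫ x in Metric.closedBall (0 : Plane) 1, f (z + r • x) =
      (r ^ 2)⁻¹ * ∫ x in Metric.closedBall z r, f x := by
  have h1 := Measure.setIntegral_comp_smul (volume : Measure Plane) (fun y => f (z + y))
    (Metric.closedBall (0 : Plane) 1) hr.ne'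
  rw [h1, finrank_euclideanSpace_fin, abs_of_pos (by positivity), smul_eq_mul,
    smul_unitClosedBall_of_nonneg hr.le]
  congr 1
  have h2 := (measurePreserving_add_left (volume : Measure Plane) z).setIntegral_preimage_emb
    (MeasurableEquiv.addLeft z).measurableEmbedding f (Metric.closedBall z r)
  rw [← h2]
  congr 2
  ext y
  simp

/-- Inverse inequality `h ‖∇q‖_{0,U} ≤ C ‖q‖_{0,U}` for polynomials `q` on a set `U` of size `h`
that contains a disk of comparable radius. -/
theorem exists_sq_gradient_le (l : ℕ) {γ : ℝ} (hγ : 0 < γ) : ∃ C : ℝ, 0 < C ∧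
    ∀ (U : Set Plane) (z : Plane) (ρ h : ℝ), MeasurableSet U → 0 < h → γ * h ≤ ρ →
      Metric.ball z ρ ⊆ U → U ⊆ Metric.closedBall z h → ∀ q, IsPoly l q →
        h ^ 2 * ∫ x in U, ‖gradient q x‖ ^ 2 ≤ C * ∫ x in U, q x ^ 2 := by
  obtain ⟨C, hC, hCq⟩ := exists_norm_gradient_sq_le l (2 / γ)
  let κ : ℝ := volume.real (Metric.ball (0 : Plane) 1)
  have hκ : 0 ≤ κ := measureReal_nonneg
  refine ⟨16 / γ ^ 4 * (κ + 1) * C, by positivity, fun U z ρ h hU hh hρ hzU hUz q hq => ?_⟩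
  have hρ0 : 0 < ρ := (mul_pos hγ hh).trans_le hρ
  -- half the radius, so that the closed disk of radius `r` lies in `U`
  set r := ρ / 2 with hr
  have hr0 : 0 < r := by positivity
  have hrU : Metric.closedBall z r ⊆ U :=
    (Metric.closedBall_subset_ball (by linarith)).trans hzU
  have hUb : Bornology.IsBounded U := Metric.isBounded_closedBall.subset hUz
  have hqc : Continuous q := (hq.contDiff (n := 1)).continuous
  have hint : IntegrableOn (fun x => q x ^ 2) U :=
    (memLp_of_continuous_of_isBounded hqc hUb).integrable_sq
  have hI : 0 ≤ ∫ x in U, q x ^ 2 := integral_nonneg fun _ => sq_nonneg _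
  set I := ∫ x in U, q x ^ 2
  have hpt : ∀ y ∈ U, ‖gradient q y‖ ^ 2 ≤ C * (r ^ 4)⁻¹ * I := by
    intro y hy
    have hx : r⁻¹ • (y - z) ∈ Metric.closedBall (0 : Plane) (2 / γ) := by
      rw [mem_closedBall_zero_iff, norm_smul, norm_inv, Real.norm_of_nonneg hr0.le,
        inv_mul_le_iff₀ hr0]
      have := hUz hy
      rw [Metric.mem_closedBall, dist_eq_norm] at this
      refine this.trans ?_
      rw [hr, div_mul_div_comm, mul_comm ρ, mul_div_mul_left _ _ two_ne_zero, le_div_iff₀ hγ]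
      linarith
    have h1 := hCq _ (hq.comp_scale z r) _ hx
    have hdiff : Differentiable ℝ q := (hq.contDiff (n := 1)).differentiable (by simp)
    rw [gradient_comp_scale hdiff, smul_inv_smul₀ hr0.ne', add_sub_cancel,
      integral_closedBall_comp_scale (fun x => q x ^ 2) z hr0, norm_smul, mul_pow,
      Real.norm_of_nonneg hr0.le] at h1
    have h2 : ∫ x in Metric.closedBall z r, q x ^ 2 ≤ I :=
      setIntegral_mono_set hint (ae_of_all _ fun _ => sq_nonneg _) hrU.eventuallyLE
    have h3 : r ^ 2 * ‖gradient q y‖ ^ 2 ≤ C * ((r ^ 2)⁻¹ * I) :=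
      h1.trans (by gcongr)
    calc ‖gradient q y‖ ^ 2 = (r ^ 2)⁻¹ * (r ^ 2 * ‖gradient q y‖ ^ 2) := by field_simp
      _ ≤ (r ^ 2)⁻¹ * (C * ((r ^ 2)⁻¹ * I)) := by gcongr
      _ = _ := by field_simp
  have hvol : volume.real U ≤ h ^ 2 * κ := by
    refine (measureReal_mono hUz measure_closedBall_lt_top.ne).trans_eq ?_
    rw [Measure.real, Measure.addHaar_closedBall _ _ hh.le, ENNReal.toReal_mul,
      ENNReal.toReal_ofReal (by positivity), finrank_euclideanSpace_fin]
    rfl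
  have hUfin : volume U ≠ ⊤ := (measure_mono hUz).trans_lt measure_closedBall_lt_top |>.ne
  have hgint : IntegrableOn (fun x => ‖gradient q x‖ ^ 2) U :=
    ((memLp_of_continuous_of_isBounded (continuous_gradient hq.contDiff) hUb).integrable_norm_pow
      (by norm_num))
  have hle : ∫ x in U, ‖gradient q x‖ ^ 2 ≤ volume.real U * (C * (r ^ 4)⁻¹ * I) := by
    refine (setIntegral_mono_on hgint (integrableOn_const hUfin) hU hpt).trans_eq ?_
    rw [setIntegral_const, smul_eq_mul]
  calc h ^ 2 * ∫ x in U, ‖gradient q x‖ ^ 2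
      ≤ h ^ 2 * (h ^ 2 * (κ + 1) * (C * (r ^ 4)⁻¹ * I)) := by
        gcongr
        refine hle.trans ?_
        gcongr
        exact hvol.trans (by gcongr; linarith)
    _ = (h ^ 4 * (r ^ 4)⁻¹) * (κ + 1) * C * I := by ring
    _ ≤ 16 / γ ^ 4 * (κ + 1) * C * I := by
        gcongr
        rw [← div_eq_mul_inv, div_le_div_iff₀ (by positivity) (by positivity)]
        have : (γ * h) ^ 4 ≤ ρ ^ 4 := by gcongr
        rw [hr]
        calc h ^ 4 * γ ^ 4 = (γ * h) ^ 4 := by ring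
          _ ≤ ρ ^ 4 := this
          _ = _ := by ring

/-! ### A trace inequality on triangles -/

theorem lintegral_segment (p u : Plane) (hu : ‖u‖ = 1) {c : ℝ} (hc : 0 < c) (f : Plane → ℝ≥0∞) :
    ∫⁻ x in segment ℝ p (p + c • u), f x ∂arc = ∫⁻ s in Ioo 0 c, f (p + s • u) := by
  let ι : ℝ → Plane := fun s => p + s • u
  have hι : Isometry ι := Isometry.of_dist_eq fun s t => by
    simp only [ι, dist_eq_norm, add_sub_add_left_eq_sub, ← sub_smul, norm_smul, hu, mul_one]
  have hseg : ι ⁻¹' segment ℝ p (p + c • u) = Icc 0 c := by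
    ext s
    rw [segment_eq_image', mem_preimage]
    constructor
    · rintro ⟨θ, hθ, h⟩
      simp only [add_sub_cancel_left, smul_smul] at h
      have : ι (θ * c) = ι s := h
      rw [← hι.injective this]
      exact ⟨mul_nonneg hθ.1 hc.le, mul_le_of_le_one_left hc.le hθ.2⟩
    · intro hs
      refine ⟨s / c, ⟨div_nonneg hs.1 hc.le, (div_le_one hc).2 hs.2⟩, ?_⟩
      simp only [add_sub_cancel_left, smul_smul, div_mul_cancel₀ _ hc.ne', ι]
  have hsub : segment ℝ p (p + c • u) ⊆ range ι := by
    rw [segment_eq_image']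
    rintro _ ⟨θ, -, rfl⟩
    exact ⟨θ * c, by simp [ι, smul_smul]⟩
  have hmap := hι.map_hausdorffMeasure (d := 1) (Or.inl zero_le_one)
  have hm : MeasurableSet (segment ℝ p (p + c • u)) := by
    rw [← convexHull_pair]
    exact ((toFinite _).isCompact_convexHull ℝ).measurableSet
  have h1 : arc.restrict (segment ℝ p (p + c • u)) =
      (Measure.map ι volume).restrict (segment ℝ p (p + c • u)) := by
    rw [← hausdorffMeasure_real, hmap, Measure.restrict_restrict hm, inter_eq_left.2 hsub]
  rw [h1, hι.isClosedEmbedding.measurableEmbedding.restrict_map,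
    hι.isClosedEmbedding.measurableEmbedding.lintegral_map, hseg]
  exact setLIntegral_congr Ioo_ae_eq_Icc.symm

/-- Integration over the triangle with apex `z` and base `{p + s u}`, in the coordinates
`(s, t) ↦ z + t (p + s u - z)`; their Jacobian determinant is `t` times the distance of `z` from the
base. -/
theorem lintegral_triangle_le (z p u : Plane) (c : ℝ) {U : Set Plane} {f : Plane → ℝ≥0∞}
    (hU : ∀ s ∈ Ioo 0 c, ∀ t ∈ Ioo (0 : ℝ) 1, z + t • (p + s • u - z) ∈ U)
    (hD : u 0 * (p 1 - z 1) - u 1 * (p 0 - z 0) ≠ 0) :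
    ENNReal.ofReal |u 0 * (p 1 - z 1) - u 1 * (p 0 - z 0)| *
      ∫⁻ y in Ioo 0 c ×ˢ Ioo (0 : ℝ) 1, ENNReal.ofReal y.2 * f (z + y.2 • (p + y.1 • u - z)) ≤
      ∫⁻ x in U, f x := by
  set D := u 0 * (p 1 - z 1) - u 1 * (p 0 - z 0) with hDdef
  let e : (ℝ × ℝ) ≃ᵐ Plane := (MeasurableEquiv.finTwoArrow.symm).trans
    (MeasurableEquiv.toLp 2 (Fin 2 → ℝ))
  have he : MeasurePreserving e volume volume :=
    (EuclideanSpace.volume_preserving_symm_measurableEquiv_toLp (Fin 2)).symm.comp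
      ((volume_preserving_finTwoArrow ℝ).symm)
  have hev : ∀ y : ℝ × ℝ, e y = !₂[y.1, y.2] := fun y => rfl
  let Ψ : ℝ × ℝ → ℝ × ℝ := fun y => (z 0 + y.2 * ((p 0 - z 0) + y.1 * u 0),
    z 1 + y.2 * ((p 1 - z 1) + y.1 * u 1))
  have hΨ : ∀ y : ℝ × ℝ, e (Ψ y) = z + y.2 • (p + y.1 • u - z) := fun y => by
    rw [hev]
    ext i
    fin_cases i <;> simp [Ψ] <;> left <;> ring
  let Ψ' : ℝ × ℝ → (ℝ × ℝ →L[ℝ] ℝ × ℝ) := fun y =>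
    (Matrix.toLin (.finTwoProd ℝ) (.finTwoProd ℝ)
      !![y.2 * u 0, (p 0 - z 0) + y.1 * u 0;
        y.2 * u 1, (p 1 - z 1) + y.1 * u 1]).toContinuousLinearMap
  have hder : ∀ y, HasFDerivAt Ψ (Ψ' y) y := by
    intro y
    simp only [Ψ']
    rw [Matrix.toLin_finTwoProd_toContinuousLinearMap]
    have h1 : ∀ a b d : ℝ, HasFDerivAt (fun y : ℝ × ℝ => d + y.2 * (a + y.1 * b))
        ((y.2 * b) • ContinuousLinearMap.fst ℝ ℝ ℝ + (a + y.1 * b) • ContinuousLinearMap.snd ℝ ℝ ℝ)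
        y := by
      intro a b d
      have h := (hasFDerivAt_snd (𝕜 := ℝ) (p := y)).mul
        (((hasFDerivAt_fst (𝕜 := ℝ) (p := y)).mul_const b).const_add a) |>.const_add d
      convert! h using 1
      rw [smul_smul]
    exact (h1 _ _ _).prodMk (h1 _ _ _)
  have hdet : ∀ y, (Ψ' y).det = y.2 * D := by
    intro y
    simp only [Ψ', LinearMap.det_toContinuousLinearMap, LinearMap.det_toLin, Matrix.det_fin_two_of]
    rw [hDdef]; ring
  have hinj : InjOn Ψ (Ioo 0 c ×ˢ Ioo (0 : ℝ) 1) := by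
    rintro ⟨s, t⟩ ⟨-, ht⟩ ⟨s', t'⟩ ⟨-, ht'⟩ h
    simp only [Ψ, Prod.mk.injEq, add_right_inj] at h
    obtain ⟨h0, h1⟩ := h
    have htt : t = t' := by
      refine mul_right_cancel₀ hD ?_
      rw [hDdef]
      linear_combination u 0 * h1 - u 1 * h0
    subst htt
    have ht0 : t ≠ 0 := ht.1.ne'
    have h0' : s * u 0 = s' * u 0 := by
      have := mul_left_cancel₀ ht0 h0
      linarith
    have h1' : s * u 1 = s' * u 1 := by
      have := mul_left_cancel₀ ht0 h1
      linarith
    have : s = s' := by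
      refine mul_right_cancel₀ hD ?_
      rw [hDdef]
      linear_combination (p 1 - z 1) * h0' - (p 0 - z 0) * h1'
    rw [this]
  have hbox : MeasurableSet (Ioo 0 c ×ˢ Ioo (0 : ℝ) 1) := measurableSet_Ioo.prod measurableSet_Ioo
  have hcv := lintegral_image_eq_lintegral_abs_det_fderiv_mul volume hbox
    (fun y _ => (hder y).hasFDerivWithinAt) hinj (fun y => f (e y))
  have hsub : Ψ '' (Ioo 0 c ×ˢ Ioo (0 : ℝ) 1) ⊆ e ⁻¹' U := by
    rintro _ ⟨y, ⟨hy1, hy2⟩, rfl⟩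
    rw [mem_preimage, hΨ]
    exact hU _ hy1 _ hy2
  calc _ = ∫⁻ y in Ioo 0 c ×ˢ Ioo (0 : ℝ) 1, ENNReal.ofReal |(Ψ' y).det| * f (e (Ψ y)) := by
        rw [← lintegral_const_mul' _ _ ENNReal.ofReal_ne_top]
        refine setLIntegral_congr_fun hbox fun y hy => ?_
        simp only [hΨ, hdet]
        rw [← mul_assoc, abs_mul, abs_of_pos hy.2.1, ENNReal.ofReal_mul hy.2.1.le,
          mul_comm (ENNReal.ofReal |D|)]
    _ = ∫⁻ y in Ψ '' (Ioo 0 c ×ˢ Ioo (0 : ℝ) 1), f (e y) := hcv.symm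
    _ ≤ ∫⁻ y in e ⁻¹' U, f (e y) := lintegral_mono_set hsub
    _ = ∫⁻ x in U, f x := he.setLIntegral_comp_preimage_emb e.measurableEmbedding f U

/-- The fundamental theorem of calculus for `t² φ²` along the segment from `z` to `x`. -/
theorem sq_le_integral_segment {φ : Plane → ℝ} (hφ : ContDiff ℝ 1 φ) {z x : Plane} {h : ℝ}
    (hx : ‖x - z‖ ≤ h) :
    φ x ^ 2 ≤ ∫ t in (0 : ℝ)..1, t * (3 * φ (z + t • (x - z)) ^ 2 +
      h ^ 2 * ‖gradient φ (z + t • (x - z))‖ ^ 2) := by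
  let y : ℝ → Plane := fun t => z + t • (x - z)
  have hy : ∀ t, HasDerivAt y (x - z) t := fun t => by
    simpa [y] using ((hasDerivAt_id t).smul_const (x - z)).const_add z
  have hyc : Continuous y := by fun_prop
  have hφd : ∀ t, HasDerivAt (fun t => φ (y t)) (inner ℝ (gradient φ (y t)) (x - z)) t := by
    intro t
    have h1 := ((hφ.differentiable (by simp)) (y t)).hasFDerivAt.comp_hasDerivAt t (hy t)
    rw [inner_gradient]
    exact h1
  let G : ℝ → ℝ := fun t => 2 * t * φ (y t) ^ 2 +
    t ^ 2 * (2 * φ (y t) * inner ℝ (gradient φ (y t)) (x - z))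
  have hder : ∀ t, HasDerivAt (fun t => t ^ 2 * φ (y t) ^ 2) (G t) t := fun t => by
    have := (hasDerivAt_pow 2 t).mul ((hφd t).pow 2)
    convert! this using 1
    simp [G]
  have hgc : Continuous fun t => gradient φ (y t) := (continuous_gradient hφ).comp hyc
  have hφc : Continuous fun t => φ (y t) := hφ.continuous.comp hyc
  have hGc : Continuous G := by
    have : Continuous fun t => inner ℝ (gradient φ (y t)) (x - z) := hgc.inner continuous_const
    fun_prop
  have hFc : Continuous fun t => t * (3 * φ (y t) ^ 2 + h ^ 2 * ‖gradient φ (y t)‖ ^ 2) := by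
    fun_prop
  have hftc := intervalIntegral.integral_eq_sub_of_hasDerivAt (a := 0) (b := 1)
    (fun t _ => hder t) (hGc.intervalIntegrable 0 1)
  have h1 : φ x ^ 2 = ∫ t in (0 : ℝ)..1, G t := by
    rw [hftc]; simp [y]
  rw [h1]
  refine intervalIntegral.integral_mono_on zero_le_one (hGc.intervalIntegrable 0 1)
    (hFc.intervalIntegrable 0 1) fun t ht => ?_
  have hin : |inner ℝ (gradient φ (y t)) (x - z)| ≤ ‖gradient φ (y t)‖ * h :=
    (abs_real_inner_le_norm _ _).trans (by gcongr)
  simp only [G]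
  have hsq : (inner ℝ (gradient φ (y t)) (x - z)) ^ 2 ≤ (‖gradient φ (y t)‖ * h) ^ 2 :=
    sq_le_sq.2 (hin.trans (le_abs_self _))
  set a := φ (y t)
  set b := inner ℝ (gradient φ (y t)) (x - z)
  have h2 : t * (2 * a * b) ≤ a ^ 2 + (‖gradient φ (y t)‖ * h) ^ 2 := by
    have h3 : |2 * a * b| ≤ a ^ 2 + b ^ 2 := abs_le.2
      ⟨by nlinarith [sq_nonneg (a + b)], by nlinarith [sq_nonneg (a - b)]⟩
    calc t * (2 * a * b) ≤ |t * (2 * a * b)| := le_abs_self _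
      _ = t * |2 * a * b| := by rw [abs_mul, abs_of_nonneg ht.1]
      _ ≤ 1 * |2 * a * b| := by gcongr; exact ht.2
      _ ≤ _ := by linarith
  calc 2 * t * a ^ 2 + t ^ 2 * (2 * a * b) = t * (2 * a ^ 2 + t * (2 * a * b)) := by ring
    _ ≤ t * (2 * a ^ 2 + (a ^ 2 + (‖gradient φ (y t)‖ * h) ^ 2)) := by
      gcongr
      exact ht.1
    _ = _ := by ring

/-- Trace inequality on the triangle with apex `z` and base from `p` to `p + c u`. -/
theorem lintegral_segment_sq_le {φ : Plane → ℝ} (hφ : ContDiff ℝ 1 φ) (z p u : Plane) {c h : ℝ}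
    (hu : ‖u‖ = 1) (hc : 0 < c) {U : Set Plane}
    (hU : ∀ s ∈ Ioo 0 c, ∀ t ∈ Ioo (0 : ℝ) 1, z + t • (p + s • u - z) ∈ U)
    (hh : ∀ s ∈ Ioo 0 c, ‖p + s • u - z‖ ≤ h)
    (hD : u 0 * (p 1 - z 1) - u 1 * (p 0 - z 0) ≠ 0) :
    ENNReal.ofReal |u 0 * (p 1 - z 1) - u 1 * (p 0 - z 0)| *
      ∫⁻ x in segment ℝ p (p + c • u), ENNReal.ofReal (φ x ^ 2) ∂arc ≤
      ∫⁻ x in U, ENNReal.ofReal (3 * φ x ^ 2 + h ^ 2 * ‖gradient φ x‖ ^ 2) := by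
  refine le_trans ?_ (lintegral_triangle_le z p u c hU hD)
  gcongr
  rw [lintegral_segment p u hu hc]
  have hF : Continuous fun x => 3 * φ x ^ 2 + h ^ 2 * ‖gradient φ x‖ ^ 2 := by
    have := hφ.continuous
    have := continuous_gradient hφ
    fun_prop
  have hFm : Measurable fun y : ℝ × ℝ => ENNReal.ofReal y.2 *
      ENNReal.ofReal (3 * φ (z + y.2 • (p + y.1 • u - z)) ^ 2 +
        h ^ 2 * ‖gradient φ (z + y.2 • (p + y.1 • u - z))‖ ^ 2) :=
    (ENNReal.measurable_ofReal.comp measurable_snd).mul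
      (ENNReal.measurable_ofReal.comp (hF.comp (by fun_prop :
        Continuous fun y : ℝ × ℝ => z + y.2 • (p + y.1 • u - z))).measurable)
  rw [Measure.volume_eq_prod, ← Measure.prod_restrict, lintegral_prod _ hFm.aemeasurable]
  refine setLIntegral_mono' measurableSet_Ioo fun s hs => ?_
  refine (ENNReal.ofReal_le_ofReal (sq_le_integral_segment hφ (hh s hs))).trans ?_
  have hcont : Continuous fun t : ℝ => t * (3 * φ (z + t • (p + s • u - z)) ^ 2 +
      h ^ 2 * ‖gradient φ (z + t • (p + s • u - z))‖ ^ 2) :=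
    continuous_id.mul (hF.comp (by fun_prop : Continuous fun t : ℝ => z + t • (p + s • u - z)))
  rw [intervalIntegral.integral_of_le zero_le_one, integral_Ioc_eq_integral_Ioo,
    ofReal_integral_eq_lintegral_ofReal]
  · refine setLIntegral_mono' measurableSet_Ioo fun t ht => ?_
    rw [ENNReal.ofReal_mul ht.1.le]
  · exact (hcont.integrableOn_Icc).mono_set Ioo_subset_Icc_self
  · exact (ae_restrict_mem measurableSet_Ioo).mono fun t ht => by
      have := ht.1
      positivity

/-! ### Star-shaped sets -/

theorem mem_interior_of_starConvex {s : Set Plane} {z : Plane} {ρ : ℝ}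
    (hs : ∀ y ∈ Metric.ball z ρ, StarConvex ℝ y s) {x y : Plane} (hx : x ∈ s)
    (hy : y ∈ Metric.ball z ρ) {a b : ℝ} (ha : 0 < a) (hb : 0 ≤ b) (hab : a + b = 1) :
    a • y + b • x ∈ interior s := by
  refine mem_interior.2 ⟨(fun w => a⁻¹ • (w - b • x)) ⁻¹' Metric.ball z ρ, fun w hw => ?_,
    Metric.isOpen_ball.preimage (by fun_prop), ?_⟩
  · have h := hs _ hw hx ha.le hb hab
    rwa [smul_inv_smul₀ ha.ne', sub_add_cancel] at h
  · simpa [inv_smul_smul₀ ha.ne'] using hy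

/-- The line through a boundary segment of a set that is star-shaped with respect to a disk does not
meet the disk. -/
theorem lineMap_notMem_ball {s : Set Plane} (hcl : IsClosed s) {z : Plane} {ρ : ℝ}
    (hs : ∀ y ∈ Metric.ball z ρ, StarConvex ℝ y s) {p q : Plane}
    (hpq : segment ℝ p q ⊆ frontier s) (r : ℝ) : p + r • (q - p) ∉ Metric.ball z ρ := by
  intro hy
  have hin : ∀ θ ∈ Icc (0 : ℝ) 1, p + θ • (q - p) ∈ frontier s := fun θ hθ => hpq (by
    rw [segment_eq_image']; exact ⟨θ, hθ, rfl⟩)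
  have key : ∀ θ ∈ Icc (0 : ℝ) 1, ∀ θ' ∈ Icc (0 : ℝ) 1, ∀ a b : ℝ, 0 < a → 0 ≤ b → a + b = 1 →
      a * r + b * θ = θ' → False := by
    intro θ hθ θ' hθ' a b ha hb hab h
    have h1 := mem_interior_of_starConvex hs (hcl.frontier_subset (hin θ hθ)) hy ha hb hab
    have h2 : a • (p + r • (q - p)) + b • (p + θ • (q - p)) = p + θ' • (q - p) := by
      rw [← h]
      calc _ = (a + b) • p + (a * r + b * θ) • (q - p) := by
            simp only [smul_add, add_smul, smul_smul]; abel
        _ = _ := by rw [hab, one_smul]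
    rw [h2] at h1
    exact (hin θ' hθ').2 h1
  rcases le_or_gt r (1 / 2) with hr | hr
  · -- the point with parameter `3 / 4` lies strictly between `r` and `1`
    have h1 : 0 < 1 - r := by linarith
    refine key 1 (by simp) (3 / 4) (by norm_num) (1 / 4 / (1 - r)) (1 - 1 / 4 / (1 - r))
      (by positivity) ?_ (by ring) ?_
    · rw [sub_nonneg, div_le_one h1]; linarith
    · field_simp; ring
  · -- the point with parameter `1 / 4` lies strictly between `0` and `r`
    have h1 : 0 < r := by linarith
    refine key 0 (by simp) (1 / 4) (by norm_num) (1 / 4 / r) (1 - 1 / 4 / r)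
      (by positivity) ?_ (by ring) ?_
    · rw [sub_nonneg, div_le_one h1]; linarith
    · field_simp; ring

theorem le_abs_cross_of_line_notMem_ball {z p u : Plane} {ρ : ℝ} (hu : ‖u‖ = 1)
    (h : ∀ r : ℝ, p + r • u ∉ Metric.ball z ρ) :
    ρ ≤ |u 0 * (p 1 - z 1) - u 1 * (p 0 - z 0)| := by
  have hu2 : u 0 ^ 2 + u 1 ^ 2 = 1 := by
    have := EuclideanSpace.norm_sq_eq u
    rw [hu, Fin.sum_univ_two] at this
    simpa using this.symm
  have h1 := h (-(u 0 * (p 0 - z 0) + u 1 * (p 1 - z 1)))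
  rw [Metric.mem_ball, dist_eq_norm, not_lt, EuclideanSpace.norm_eq, Fin.sum_univ_two] at h1
  refine h1.trans_eq ?_
  rw [← Real.sqrt_sq_eq_abs]
  congr 1
  simp only [PiLp.sub_apply, PiLp.add_apply, PiLp.smul_apply, smul_eq_mul, Real.norm_eq_abs, sq_abs]
  linear_combination (u 0 * (p 0 - z 0) + u 1 * (p 1 - z 1)) ^ 2 * hu2 -
    ((p 0 - z 0) ^ 2 + (p 1 - z 1) ^ 2) * hu2

/-! ### Square integrable functions -/

section L2

variable {α E : Type*} [MeasurableSpace α] {μ : Measure α} [NormedAddCommGroup E]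

theorem eLpNorm_two_sq (f : α → E) : eLpNorm f 2 μ ^ 2 = ∫⁻ x, ‖f x‖ₑ ^ 2 ∂μ := by
  have h := eLpNorm_nnreal_pow_eq_lintegral (μ := μ) (f := f) (p := 2) two_ne_zero
  simp only [NNReal.coe_ofNat, ENNReal.coe_ofNat, ENNReal.rpow_ofNat] at h
  exact h

theorem enorm_sq_eq_ofReal (x : E) : ‖x‖ₑ ^ 2 = ENNReal.ofReal (‖x‖ ^ 2) := by
  rw [ENNReal.ofReal_pow (norm_nonneg _), ofReal_norm]

theorem ofReal_integral_norm_sq {f : α → E} (hf : MemLp f 2 μ) :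
    ENNReal.ofReal (∫ x, ‖f x‖ ^ 2 ∂μ) = eLpNorm f 2 μ ^ 2 := by
  rw [eLpNorm_two_sq, ofReal_integral_eq_lintegral_ofReal (hf.integrable_norm_pow (by norm_num))
    (ae_of_all _ fun _ => by positivity)]
  simp only [enorm_sq_eq_ofReal]

theorem tendsto_eLpNorm_linearComb [NormedSpace ℝ E] {f g : ℕ → α → E} {u v : α → E}
    (hf : ∀ n, AEStronglyMeasurable (f n) μ) (hg : ∀ n, AEStronglyMeasurable (g n) μ)
    (hu : AEStronglyMeasurable u μ) (hv : AEStronglyMeasurable v μ)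
    (h1 : Tendsto (fun n => eLpNorm (fun x => f n x - u x) 2 μ) atTop (𝓝 0))
    (h2 : Tendsto (fun n => eLpNorm (fun x => g n x - v x) 2 μ) atTop (𝓝 0)) (s t : ℝ) :
    Tendsto (fun n => eLpNorm (fun x => (s • f n x + t • g n x) - (s • u x + t • v x)) 2 μ)
      atTop (𝓝 0) := by
  have h3 : Tendsto (fun n => ‖s‖ₑ * eLpNorm (fun x => f n x - u x) 2 μ +
      ‖t‖ₑ * eLpNorm (fun x => g n x - v x) 2 μ) atTop (𝓝 0) := by
    simpa using (ENNReal.Tendsto.const_mul h1 (Or.inr enorm_ne_top)).add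
      (ENNReal.Tendsto.const_mul (a := ‖t‖ₑ) h2 (Or.inr enorm_ne_top))
  refine tendsto_of_tendsto_of_tendsto_of_le_of_le tendsto_const_nhds h3 (fun _ => zero_le)
    fun n => ?_
  have e : (fun x => (s • f n x + t • g n x) - (s • u x + t • v x)) =
      (s • fun x => f n x - u x) + (t • fun x => g n x - v x) := by
    funext x
    simp only [Pi.add_apply, Pi.smul_apply, smul_sub]
    abel
  simp only [e]
  refine (eLpNorm_add_le (((hf n).sub hu).const_smul s) (((hg n).sub hv).const_smul t)
    (by norm_num)).trans_eq ?_
  rw [eLpNorm_const_smul, eLpNorm_const_smul]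
  rfl

theorem integrable_mul_of_memLp {f g : α → ℝ} (hf : MemLp f 2 μ) (hg : MemLp g 2 μ) :
    Integrable (fun x => f x * g x) μ := hf.integrable_mul hg

theorem integrable_inner_of_memLp [InnerProductSpace ℝ E] {f g : α → E} (hf : MemLp f 2 μ)
    (hg : MemLp g 2 μ) : Integrable (fun x => (inner ℝ (f x) (g x) : ℝ)) μ :=
  (integrable_mul_of_memLp hf.norm hg.norm).mono (hf.1.inner hg.1)
    (ae_of_all _ fun x => by simpa using abs_real_inner_le_norm (f x) (g x))

theorem integral_linearComb {f g : α → ℝ} (hf : Integrable f μ) (hg : Integrable g μ) (s t : ℝ) :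
    ∫ x, (s * f x + t * g x) ∂μ = s * ∫ x, f x ∂μ + t * ∫ x, g x ∂μ := by
  rw [integral_add (hf.const_mul s) (hg.const_mul t), integral_const_mul, integral_const_mul]

end L2

namespace SimplePolygon

variable (K : SimplePolygon)

/-! ### Star-shaped polygons -/

theorem isClosed_carrier : IsClosed K.carrier := K.isCompact_carrier.isClosed

theorem isOpen_region : IsOpen K.region := isOpen_interior

theorem measurableSet_region : MeasurableSet K.region := K.isOpen_region.measurableSet

theorem region_subset : K.region ⊆ K.carrier := interior_subset

theorem bdry_subset : K.bdry ⊆ K.carrier := K.isClosed_carrier.frontier_subset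

theorem isBounded_region : Bornology.IsBounded K.region :=
  K.isCompact_carrier.isBounded.subset K.region_subset

instance : IsFiniteMeasure (volume.restrict K.region) :=
  ⟨by rw [Measure.restrict_apply_univ]; exact K.isBounded_region.measure_lt_top⟩

theorem dist_le_diam {x y : Plane} (hx : x ∈ K.carrier) (hy : y ∈ K.carrier) :
    dist x y ≤ K.diam :=
  Metric.dist_le_diam_of_mem K.isCompact_carrier.isBounded hx hy

theorem bdry_eq : K.bdry = ⋃ i, K.side i := K.frontier_carrier

theorem side_subset_bdry (i : Fin (K.m + 3)) : K.side i ⊆ K.bdry := by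
  rw [bdry_eq]; exact subset_iUnion _ i

theorem vertex_ne (i : Fin (K.m + 3)) : K.vertex i ≠ K.vertex (i + 1) := fun h => by
  have h1 := K.vertex_injective h
  have : (1 : Fin (K.m + 3)) = 0 := by simpa using h1.symm
  exact absurd this (by simp)

theorem vertex_mem (i : Fin (K.m + 3)) : K.vertex i ∈ K.carrier :=
  K.bdry_subset (K.side_subset_bdry i (left_mem_segment ℝ _ _))

theorem diam_pos : 0 < K.diam :=
  (dist_pos.2 (K.vertex_ne 0)).trans_le (K.dist_le_diam (K.vertex_mem _) (K.vertex_mem _))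

theorem measurableSet_bdry : MeasurableSet K.bdry := isClosed_frontier.measurableSet

theorem isCompact_bdry : IsCompact K.bdry :=
  K.isCompact_carrier.of_isClosed_subset isClosed_frontier K.bdry_subset

theorem arc_side (i : Fin (K.m + 3)) : arc (K.side i) = edist (K.vertex i) (K.vertex (i + 1)) :=
  hausdorffMeasure_segment _ _

theorem arc_bdry_lt_top : arc K.bdry < ⊤ := by
  rw [bdry_eq]
  refine (measure_iUnion_le _).trans_lt ?_
  rw [tsum_fintype]
  exact ENNReal.sum_lt_top.2 fun i _ => by rw [K.arc_side]; exact edist_lt_top _ _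

theorem arc_bdry_pos : 0 < arc K.bdry := by
  refine lt_of_lt_of_le ?_ (measure_mono (K.side_subset_bdry 0))
  rw [K.arc_side]
  exact edist_pos.2 (K.vertex_ne 0)

instance : IsFiniteMeasure (arc.restrict K.bdry) :=
  ⟨by rw [Measure.restrict_apply_univ]; exact K.arc_bdry_lt_top⟩

/-- `K` is star-shaped with respect to every point of the disk of radius `ρ > 0` about `z`. -/
structure IsStarDisk (z : Plane) (ρ : ℝ) : Prop where
  pos : 0 < ρ
  ball_subset : Metric.ball z ρ ⊆ K.carrier
  starConvex : ∀ y ∈ Metric.ball z ρ, StarConvex ℝ y K.carrier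

variable {K} {z : Plane} {ρ : ℝ}

theorem IsStarDisk.ball_subset_region (h : K.IsStarDisk z ρ) : Metric.ball z ρ ⊆ K.region :=
  interior_maximal h.ball_subset Metric.isOpen_ball

theorem IsStarDisk.center_mem (h : K.IsStarDisk z ρ) : z ∈ K.carrier :=
  h.ball_subset (Metric.mem_ball_self h.pos)

theorem IsStarDisk.region_subset_closedBall (h : K.IsStarDisk z ρ) :
    K.region ⊆ Metric.closedBall z K.diam := fun _ hx =>
  K.dist_le_diam (K.region_subset hx) h.center_mem

/-- Trace inequality on the triangle spanned by a side and the centre of the disk; the side has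
distance at least `ρ` from the centre. -/
theorem IsStarDisk.lintegral_side_le (h : K.IsStarDisk z ρ) (i : Fin (K.m + 3)) {φ : Plane → ℝ}
    (hφ : ContDiff ℝ 1 φ) :
    ENNReal.ofReal ρ * ∫⁻ x in K.side i, ENNReal.ofReal (φ x ^ 2) ∂arc ≤
      ∫⁻ x in K.region, ENNReal.ofReal (3 * φ x ^ 2 + K.diam ^ 2 * ‖gradient φ x‖ ^ 2) := by
  set p := K.vertex i
  set q := K.vertex (i + 1)
  set c := ‖q - p‖ with hcdef
  have hc : 0 < c := norm_pos_iff.2 (sub_ne_zero.2 (K.vertex_ne i).symm)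
  set u := c⁻¹ • (q - p)
  have hu : ‖u‖ = 1 := by
    rw [norm_smul, norm_inv, Real.norm_of_nonneg hc.le, ← hcdef, inv_mul_cancel₀ hc.ne']
  have hcu : c • u = q - p := smul_inv_smul₀ hc.ne' _
  have hseg : K.side i = segment ℝ p (p + c • u) := by
    rw [hcu, add_sub_cancel]; rfl
  have hfr : segment ℝ p q ⊆ frontier K.carrier := K.side_subset_bdry i
  have hline : ∀ r : ℝ, p + r • u ∉ Metric.ball z ρ := fun r => by
    have := lineMap_notMem_ball K.isClosed_carrier h.starConvex hfr (r * c⁻¹)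
    rwa [mul_smul] at this
  have hD := le_abs_cross_of_line_notMem_ball hu hline
  have hmem : ∀ s ∈ Ioo 0 c, p + s • u ∈ K.carrier := fun s hs => by
    refine K.bdry_subset (K.side_subset_bdry i ?_)
    rw [hseg, segment_eq_image']
    refine ⟨s / c, ⟨div_nonneg hs.1.le hc.le, (div_le_one hc).2 hs.2.le⟩, ?_⟩
    simp only [add_sub_cancel_left, smul_smul, div_mul_cancel₀ _ hc.ne']
  rw [hseg]
  refine le_trans (by gcongr) (lintegral_segment_sq_le hφ z p u hu hc (fun s hs t ht => ?_)
    (fun s hs => ?_) (abs_pos.1 (h.pos.trans_le hD)))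
  · have := mem_interior_of_starConvex h.starConvex (hmem s hs) (Metric.mem_ball_self h.pos)
      (a := 1 - t) (b := t) (by linarith [ht.2]) ht.1.le (by ring)
    convert! this using 1
    rw [sub_smul, one_smul, smul_sub]
    abel
  · rw [← dist_eq_norm]
    exact K.dist_le_diam (hmem s hs) h.center_mem

theorem IsStarDisk.lintegral_bdry_le (h : K.IsStarDisk z ρ) {φ : Plane → ℝ}
    (hφ : ContDiff ℝ 1 φ) :
    ENNReal.ofReal ρ * ∫⁻ x in K.bdry, ENNReal.ofReal (φ x ^ 2) ∂arc ≤
      (K.m + 3 : ℕ) * ∫⁻ x in K.region,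
        ENNReal.ofReal (3 * φ x ^ 2 + K.diam ^ 2 * ‖gradient φ x‖ ^ 2) := by
  rw [bdry_eq]
  calc _ ≤ ENNReal.ofReal ρ * ∑ i, ∫⁻ x in K.side i, ENNReal.ofReal (φ x ^ 2) ∂arc := by
        gcongr
        exact (lintegral_iUnion_le _ _).trans_eq (tsum_fintype _)
    _ ≤ ∑ _i : Fin (K.m + 3), ∫⁻ x in K.region,
          ENNReal.ofReal (3 * φ x ^ 2 + K.diam ^ 2 * ‖gradient φ x‖ ^ 2) := by
        rw [Finset.mul_sum]
        exact Finset.sum_le_sum fun i _ => h.lintegral_side_le i hφ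
    _ = _ := by rw [Finset.sum_const, Finset.card_univ, Fintype.card_fin, nsmul_eq_mul]

/-- The trace inequality for smooth functions on a star-shaped polygon. -/
theorem IsStarDisk.eLpNorm_bdry_le (h : K.IsStarDisk z ρ) {φ : Plane → ℝ}
    (hφ : ContDiff ℝ 1 φ) :
    eLpNorm φ 2 (arc.restrict K.bdry) ≤
      ENNReal.ofReal √(3 * (K.m + 3 : ℕ) / ρ) * eLpNorm φ 2 (volume.restrict K.region) +
      ENNReal.ofReal (√((K.m + 3 : ℕ) / ρ) * K.diam) *
        eLpNorm (gradient φ) 2 (volume.restrict K.region) := by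
  have hρ := h.pos
  set N : ℝ := ((K.m + 3 : ℕ) : ℝ) with hN
  have hN0 : 0 ≤ N := Nat.cast_nonneg _
  rw [← ENNReal.pow_le_pow_left_iff (two_ne_zero)]
  set x := eLpNorm φ 2 (volume.restrict K.region) with hx
  set y := eLpNorm (gradient φ) 2 (volume.restrict K.region) with hy
  have h1 := h.lintegral_bdry_le hφ
  have e1 : ∫⁻ x in K.bdry, ENNReal.ofReal (φ x ^ 2) ∂arc =
      eLpNorm φ 2 (arc.restrict K.bdry) ^ 2 := by
    rw [eLpNorm_two_sq]; simp only [enorm_sq_eq_ofReal, Real.norm_eq_abs, sq_abs]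
  have e2 : ∫⁻ x in K.region, ENNReal.ofReal (3 * φ x ^ 2 + K.diam ^ 2 * ‖gradient φ x‖ ^ 2) =
      ENNReal.ofReal 3 * x ^ 2 + ENNReal.ofReal (K.diam ^ 2) * y ^ 2 := by
    rw [hx, hy, eLpNorm_two_sq, eLpNorm_two_sq, ← lintegral_const_mul' _ _ ENNReal.ofReal_ne_top,
      ← lintegral_const_mul' _ _ ENNReal.ofReal_ne_top, ← lintegral_add_left]
    · refine lintegral_congr fun w => ?_
      rw [ENNReal.ofReal_add (by positivity) (by positivity), ENNReal.ofReal_mul (by norm_num),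
        ENNReal.ofReal_mul (by positivity)]
      simp only [enorm_sq_eq_ofReal, Real.norm_eq_abs, sq_abs]
    · exact (hφ.continuous.enorm.measurable.pow_const 2).const_mul _
  rw [e1, e2, ← ENNReal.ofReal_natCast, ← hN] at h1
  calc eLpNorm φ 2 (arc.restrict K.bdry) ^ 2
      = ENNReal.ofReal ρ⁻¹ * (ENNReal.ofReal ρ * eLpNorm φ 2 (arc.restrict K.bdry) ^ 2) := by
        rw [← mul_assoc, ← ENNReal.ofReal_mul (by positivity), inv_mul_cancel₀ hρ.ne',
          ENNReal.ofReal_one, one_mul]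
    _ ≤ ENNReal.ofReal ρ⁻¹ * (ENNReal.ofReal N *
          (ENNReal.ofReal 3 * x ^ 2 + ENNReal.ofReal (K.diam ^ 2) * y ^ 2)) := by gcongr
    _ = ENNReal.ofReal (ρ⁻¹ * (N * 3)) * x ^ 2 +
          ENNReal.ofReal (ρ⁻¹ * (N * K.diam ^ 2)) * y ^ 2 := by
        rw [ENNReal.ofReal_mul (by positivity), ENNReal.ofReal_mul hN0,
          ENNReal.ofReal_mul (by positivity), ENNReal.ofReal_mul hN0]
        ring
    _ = (ENNReal.ofReal √(3 * N / ρ) * x) ^ 2 +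
          (ENNReal.ofReal (√(N / ρ) * K.diam) * y) ^ 2 := by
        rw [mul_pow, mul_pow, ← ENNReal.ofReal_pow (by positivity),
          ← ENNReal.ofReal_pow (mul_nonneg (Real.sqrt_nonneg _) K.diam_pos.le), mul_pow,
          Real.sq_sqrt (by positivity), Real.sq_sqrt (by positivity)]
        congr 3 <;> ring
    _ ≤ _ := by
        rw [add_sq]
        gcongr
        exact le_self_add

/-! ### Traces -/

/-- The trace inequality for functions of `H¹(K)`, by density. -/
theorem IsTrace.eLpNorm_le (h : K.IsStarDisk z ρ) {v g : Plane → ℝ} (hg : K.IsTrace v g) :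
    eLpNorm g 2 (arc.restrict K.bdry) ≤
      ENNReal.ofReal √(3 * (K.m + 3 : ℕ) / ρ) * eLpNorm v 2 (volume.restrict K.region) +
      ENNReal.ofReal (√((K.m + 3 : ℕ) / ρ) * K.diam) *
        eLpNorm (wgrad K.region v) 2 (volume.restrict K.region) := by
  obtain ⟨hv, hgL, φ, hφ, h1, h2, h3⟩ := hg
  set a := ENNReal.ofReal √(3 * (K.m + 3 : ℕ) / ρ)
  set b := ENNReal.ofReal (√((K.m + 3 : ℕ) / ρ) * K.diam)
  set X := eLpNorm v 2 (volume.restrict K.region)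
  set Y := eLpNorm (wgrad K.region v) 2 (volume.restrict K.region)
  have hlim : Tendsto (fun n => eLpNorm (fun x => φ n x - g x) 2 (arc.restrict K.bdry) +
      (a * (eLpNorm (fun x => φ n x - v x) 2 (volume.restrict K.region) + X) +
      b * (eLpNorm (fun x => gradient (φ n) x - wgrad K.region v x) 2
        (volume.restrict K.region) + Y))) atTop (𝓝 (0 + (a * (0 + X) + b * (0 + Y)))) :=
    h3.add ((ENNReal.Tendsto.const_mul (h1.add_const X) (Or.inr ENNReal.ofReal_ne_top)).add
      (ENNReal.Tendsto.const_mul (h2.add_const Y) (Or.inr ENNReal.ofReal_ne_top)))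
  simp only [zero_add] at hlim
  refine ge_of_tendsto' hlim fun n => ?_
  have hφ1 : ContDiff ℝ 1 (φ n) := (hφ n).of_le (by simp)
  have tri : ∀ {F : Type} [NormedAddCommGroup F] {μ : Measure Plane} {f k : Plane → F},
      AEStronglyMeasurable f μ → AEStronglyMeasurable k μ →
      eLpNorm f 2 μ ≤ eLpNorm (fun x => f x - k x) 2 μ + eLpNorm k 2 μ := by
    intro F _ μ f k hf hk
    have := eLpNorm_add_le (hf.sub hk) hk (p := 2) (by norm_num)
    rw [sub_add_cancel] at this
    exact this
  have t1 : eLpNorm g 2 (arc.restrict K.bdry) ≤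
      eLpNorm (fun x => φ n x - g x) 2 (arc.restrict K.bdry) +
        eLpNorm (φ n) 2 (arc.restrict K.bdry) := by
    have := tri hgL.1 (hφ1.continuous.aestronglyMeasurable (μ := arc.restrict K.bdry))
    rwa [show (fun x => g x - φ n x) = g - φ n from rfl, eLpNorm_sub_comm] at this
  refine t1.trans ?_
  gcongr
  refine (h.eLpNorm_bdry_le hφ1).trans ?_
  gcongr
  · exact tri hφ1.continuous.aestronglyMeasurable hv.1.1
  · exact tri (continuous_gradient hφ1).aestronglyMeasurable (memLp_wgrad _ _).1

theorem IsTrace.linearComb {u v g k : Plane → ℝ} (hu : K.IsTrace u g) (hv : K.IsTrace v k)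
    (s t : ℝ) : K.IsTrace (fun x => s * u x + t * v x) fun x => s * g x + t * k x := by
  obtain ⟨hu, hg, φ, hφ, a1, a2, a3⟩ := hu
  obtain ⟨hv, hk, ψ, hψ, b1, b2, b3⟩ := hv
  refine ⟨hu.linearComb hv s t, (hg.const_mul s).add (hk.const_mul t),
    fun n x => s * φ n x + t * ψ n x,
    fun n => (contDiff_const.mul (hφ n)).add (contDiff_const.mul (hψ n)), ?_, ?_, ?_⟩
  · exact tendsto_eLpNorm_linearComb (fun n => (hφ n).continuous.aestronglyMeasurable)
      (fun n => (hψ n).continuous.aestronglyMeasurable) hu.1.1 hv.1.1 a1 b1 s t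
  · have h := tendsto_eLpNorm_linearComb
      (fun n => (continuous_gradient ((hφ n).of_le (by simp))).aestronglyMeasurable)
      (fun n => (continuous_gradient ((hψ n).of_le (by simp))).aestronglyMeasurable)
      (memLp_wgrad _ _).1 (memLp_wgrad _ _).1 a2 b2 s t
    refine h.congr fun n => eLpNorm_congr_ae ?_
    filter_upwards [wgrad_linearComb K.isOpen_region hu hv s t] with x hx
    rw [hx, gradient_linearComb ((hφ n).differentiable (by simp))
      ((hψ n).differentiable (by simp))]
  · exact tendsto_eLpNorm_linearComb (fun n => (hφ n).continuous.aestronglyMeasurable)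
      (fun n => (hψ n).continuous.aestronglyMeasurable) hg.1 hk.1 a3 b3 s t

/-- On a star-shaped polygon traces are unique almost everywhere. -/
theorem IsTrace.ae_eq (h : K.IsStarDisk z ρ) {v g k : Plane → ℝ} (hg : K.IsTrace v g)
    (hk : K.IsTrace v k) : g =ᵐ[arc.restrict K.bdry] k := by
  have h1 := (hg.linearComb hk 1 (-1)).eLpNorm_le h
  have h2 : eLpNorm (fun x => 1 * v x + -1 * v x) 2 (volume.restrict K.region) = 0 := by
    simp
  have h3 : eLpNorm (wgrad K.region fun x => 1 * v x + -1 * v x) 2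
      (volume.restrict K.region) = 0 := by
    rw [eLpNorm_congr_ae (wgrad_linearComb K.isOpen_region hg.1 hg.1 1 (-1))]
    simp
  have hm : AEStronglyMeasurable (fun x => 1 * g x + -1 * k x) (arc.restrict K.bdry) :=
    ((hg.2.1.const_mul 1).add (hk.2.1.const_mul (-1))).1
  rw [h2, h3, mul_zero, mul_zero, add_zero, nonpos_iff_eq_zero,
    eLpNorm_eq_zero_iff hm (by norm_num)] at h1
  filter_upwards [h1] with x hx
  simp only [Pi.zero_apply] at hx
  linarith

theorem isTrace_of_contDiff (K : SimplePolygon) {f : Plane → ℝ} (hf : ContDiff ℝ ∞ f) :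
    K.IsTrace f f := by
  have hf1 : ContDiff ℝ 1 f := hf.of_le (by simp)
  refine ⟨memH1_of_contDiff K.isBounded_region hf1, ?_, fun _ => f, fun _ => hf, ?_, ?_, ?_⟩
  · obtain ⟨C, hC⟩ := (K.isCompact_bdry.image hf.continuous).isBounded.exists_norm_le
    exact MemLp.of_bound hf.continuous.aestronglyMeasurable C
      ((ae_restrict_mem K.measurableSet_bdry).mono fun x hx => hC _ (mem_image_of_mem f hx))
  · simp
  · have : eLpNorm (fun x => gradient f x - wgrad K.region f x) 2
        (volume.restrict K.region) = 0 := by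
      rw [← eLpNorm_zero (α := Plane) (ε := Plane) (p := 2) (μ := volume.restrict K.region)]
      refine eLpNorm_congr_ae ?_
      filter_upwards [wgrad_ae_eq K.isOpen_region
        (isWeakGrad_gradient K.isBounded_region hf1)] with x hx
      simp [hx]
    simp [this]
  · simp

theorem isTrace_trace {v : Plane → ℝ} (h : ∃ g, K.IsTrace v g) : K.IsTrace v (K.trace v) := by
  rw [trace, dif_pos h]; exact h.choose_spec

theorem IsTrace.trace_ae_eq (h : K.IsStarDisk z ρ) {v g : Plane → ℝ} (hg : K.IsTrace v g) :
    K.trace v =ᵐ[arc.restrict K.bdry] g :=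
  (isTrace_trace ⟨g, hg⟩).ae_eq h hg

theorem memLp_trace (K : SimplePolygon) (v : Plane → ℝ) :
    MemLp (K.trace v) 2 (arc.restrict K.bdry) := by
  by_cases h : ∃ g, K.IsTrace v g
  · exact (isTrace_trace h).2.1
  · rw [trace, dif_neg h]; exact MemLp.zero

theorem sqL2_nonneg (v : Plane → ℝ) : 0 ≤ K.sqL2 v := integral_nonneg fun _ => sq_nonneg _

theorem sqGrad_nonneg (v : Plane → ℝ) : 0 ≤ K.sqGrad v := integral_nonneg fun _ => by positivity

/-- The scaled trace inequality `h ‖v‖²_{0,∂K} ≤ C (‖v‖²_{0,K} + h² ‖∇v‖²_{0,K})`; it also holds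
when `trace` is zero by convention. -/
theorem IsStarDisk.diam_mul_integral_trace_le (h : K.IsStarDisk z ρ) {γ : ℝ} (hγ : 0 < γ)
    (hρ : γ * K.diam ≤ ρ) (v : Plane → ℝ) :
    K.diam * ∫ x in K.bdry, K.trace v x ^ 2 ∂arc ≤
      6 * (K.m + 3 : ℕ) / γ * (K.sqL2 v + K.diam ^ 2 * K.sqGrad v) := by
  have hd := K.diam_pos
  by_cases hv : ∃ g, K.IsTrace v g
  swap
  · rw [trace, dif_neg hv]
    have := sqL2_nonneg (K := K) v
    have := sqGrad_nonneg (K := K) v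
    simp only [Pi.zero_apply, ne_eq, OfNat.ofNat_ne_zero, not_false_eq_true, zero_pow,
      integral_zero, mul_zero]
    positivity
  have ht := isTrace_trace hv
  have hle := ht.eLpNorm_le h
  set N : ℝ := ((K.m + 3 : ℕ) : ℝ) with hN
  have hN0 : 0 ≤ N := Nat.cast_nonneg _
  have real : ∀ {F : Type} [NormedAddCommGroup F] {μ : Measure Plane} {f : Plane → F},
      MemLp f 2 μ → eLpNorm f 2 μ = ENNReal.ofReal √(∫ x, ‖f x‖ ^ 2 ∂μ) := by
    intro F _ μ f hf
    have h1 := ofReal_integral_norm_sq hf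
    have h0 : 0 ≤ ∫ x, ‖f x‖ ^ 2 ∂μ := integral_nonneg fun _ => by positivity
    rw [← Real.sq_sqrt h0, ENNReal.ofReal_pow (Real.sqrt_nonneg _)] at h1
    exact ((ENNReal.pow_right_strictMono two_ne_zero).injective h1).symm
  have hρ0 := h.pos
  rw [real ht.2.1, real ht.1.1, real (memLp_wgrad _ _), ← ENNReal.ofReal_mul (by positivity),
    ← ENNReal.ofReal_mul (by positivity), ← ENNReal.ofReal_add (by positivity) (by positivity),
    ENNReal.ofReal_le_ofReal_iff (by positivity)] at hle
  simp only [Real.norm_eq_abs, sq_abs] at hle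
  change √(∫ x in K.bdry, K.trace v x ^ 2 ∂arc) ≤ √(3 * N / ρ) * √(K.sqL2 v) +
    √(N / ρ) * K.diam * √(K.sqGrad v) at hle
  have hT : 0 ≤ ∫ x in K.bdry, K.trace v x ^ 2 ∂arc := integral_nonneg fun _ => sq_nonneg _
  have hsq := pow_le_pow_left₀ (Real.sqrt_nonneg _) hle 2
  rw [Real.sq_sqrt hT] at hsq
  have h2 : (√(3 * N / ρ) * √(K.sqL2 v) + √(N / ρ) * K.diam * √(K.sqGrad v)) ^ 2 ≤
      2 * (3 * N / ρ * K.sqL2 v + N / ρ * K.diam ^ 2 * K.sqGrad v) := by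
    refine (add_sq_le).trans_eq ?_
    rw [mul_pow, mul_pow, mul_pow, Real.sq_sqrt (show 0 ≤ 3 * N / ρ by positivity),
      Real.sq_sqrt (show 0 ≤ N / ρ by positivity), Real.sq_sqrt (sqL2_nonneg v),
      Real.sq_sqrt (sqGrad_nonneg v)]
  have hA := sqL2_nonneg (K := K) v
  have hB := sqGrad_nonneg (K := K) v
  have h3 : 2 * (3 * N / ρ * K.sqL2 v + N / ρ * K.diam ^ 2 * K.sqGrad v) ≤
      6 * N / ρ * (K.sqL2 v + K.diam ^ 2 * K.sqGrad v) := by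
    have : 0 ≤ N / ρ * (K.diam ^ 2 * K.sqGrad v) := by positivity
    calc _ = 6 * N / ρ * K.sqL2 v + 2 * (N / ρ * (K.diam ^ 2 * K.sqGrad v)) := by ring
      _ ≤ 6 * N / ρ * K.sqL2 v + 6 * (N / ρ * (K.diam ^ 2 * K.sqGrad v)) := by linarith
      _ = _ := by ring
  have h4 : K.diam * (6 * N / ρ) ≤ 6 * N / γ := by
    rw [mul_div_assoc', div_le_div_iff₀ hρ0 hγ]
    calc K.diam * (6 * N) * γ = 6 * N * (γ * K.diam) := by ring
      _ ≤ _ := by gcongr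
  calc _ ≤ K.diam * (6 * N / ρ * (K.sqL2 v + K.diam ^ 2 * K.sqGrad v)) := by
        gcongr
        exact hsq.trans (h2.trans h3)
    _ = K.diam * (6 * N / ρ) * (K.sqL2 v + K.diam ^ 2 * K.sqGrad v) := by ring
    _ ≤ _ := by gcongr

end SimplePolygon

/-- The Cauchy–Schwarz inequality for a positive semidefinite quadratic form in two variables. -/
theorem abs_le_sqrt_mul_sqrt {A B C : ℝ}
    (h : ∀ s t : ℝ, 0 ≤ s ^ 2 * A + 2 * s * t * B + t ^ 2 * C) : |B| ≤ √A * √C := by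
  have hA : 0 ≤ A := by simpa using h 1 0
  have h1 := discrim_le_zero (a := A) (b := 2 * B) (c := C) fun x => by
    have := h x 1
    linarith
  rw [discrim] at h1
  rw [← Real.sqrt_mul hA]
  exact Real.abs_le_sqrt (by linarith)

namespace SimplePolygon

variable {K : SimplePolygon} {z : Plane} {ρ : ℝ}

/-! ### The projection onto affine functions -/

theorem wgrad_affine (K : SimplePolygon) (d : Plane) (c : ℝ) :
    wgrad K.region (fun x => inner ℝ d x + c) =ᵐ[volume.restrict K.region] fun _ => d := by
  have h := wgrad_ae_eq K.isOpen_region (isWeakGrad_gradient K.isBounded_region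
    ((isPoly_affine d c).contDiff (n := 1)))
  filter_upwards [h] with x hx
  rw [hx, gradient_affine]

theorem integral_inner_wgrad_affine (K : SimplePolygon) (v : Plane → ℝ) (d : Plane) (c : ℝ) :
    ∫ x in K.region, inner ℝ (wgrad K.region v x) (wgrad K.region (fun x => inner ℝ d x + c) x) =
      inner ℝ (∫ x in K.region, wgrad K.region v x) d := by
  have h : ∫ x in K.region,
      inner ℝ (wgrad K.region v x) (wgrad K.region (fun x => inner ℝ d x + c) x) =
      ∫ x in K.region, inner ℝ d (wgrad K.region v x) := by
    refine integral_congr_ae ?_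
    filter_upwards [K.wgrad_affine d c] with x hx
    rw [hx, real_inner_comm]
  rw [h, integral_inner ((memLp_wgrad _ v).integrable (by norm_num)), real_inner_comm]

theorem integral_wgrad_affine (K : SimplePolygon) (d : Plane) (c : ℝ) :
    ∫ x in K.region, wgrad K.region (fun x => inner ℝ d x + c) x = volume.real K.region • d := by
  rw [integral_congr_ae (K.wgrad_affine d c), setIntegral_const]

theorem volume_region_pos (K : SimplePolygon) : 0 < volume.real K.region :=
  ENNReal.toReal_pos (K.isOpen_region.measure_pos volume K.nonempty_interior).ne'
    K.isBounded_region.measure_lt_top.ne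

theorem arc_real_bdry_pos (K : SimplePolygon) : 0 < arc.real K.bdry :=
  ENNReal.toReal_pos K.arc_bdry_pos.ne' K.arc_bdry_lt_top.ne

theorem memLp_of_isPoly (K : SimplePolygon) {l : ℕ} {p : Plane → ℝ} (hp : IsPoly l p) :
    MemLp p 2 (volume.restrict K.region) :=
  memLp_of_continuous_of_isBounded (hp.contDiff (n := 0)).continuous K.isBounded_region

theorem integrable_trace (K : SimplePolygon) (v : Plane → ℝ) :
    Integrable (K.trace v) (arc.restrict K.bdry) :=
  (K.memLp_trace v).integrable (by norm_num)

theorem integrable_bdry_of_isPoly (K : SimplePolygon) {l : ℕ} {p : Plane → ℝ} (hp : IsPoly l p) :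
    Integrable p (arc.restrict K.bdry) :=
  (K.isTrace_of_contDiff hp.contDiff).2.1.integrable (by norm_num)

theorem exists_isProj (K : SimplePolygon) (v : Plane → ℝ) : ∃ π, K.IsProj v π := by
  set d := (volume.real K.region)⁻¹ • ∫ x in K.region, wgrad K.region v x with hd
  set c := (arc.real K.bdry)⁻¹ * ∫ x in K.bdry, (K.trace v x - (inner ℝ d x + 0)) ∂arc with hc
  refine ⟨fun x => inner ℝ d x + c, isPoly_affine d c, fun p hp => ?_, ?_⟩
  · obtain ⟨e, b, rfl⟩ := hp.eq_affine
    rw [integral_inner_wgrad_affine, integral_inner_wgrad_affine, integral_wgrad_affine, hd,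
      smul_inv_smul₀ K.volume_region_pos.ne']
  · have h1 : ∀ x, K.trace v x - (inner ℝ d x + c) = (K.trace v x - (inner ℝ d x + 0)) - c :=
      fun x => by ring
    have hi : Integrable (fun x => K.trace v x - (inner ℝ d x + 0)) (arc.restrict K.bdry) :=
      (K.integrable_trace v).sub (K.integrable_bdry_of_isPoly (isPoly_affine d 0))
    simp only [h1]
    rw [integral_sub hi (integrable_const c), setIntegral_const, smul_eq_mul, hc,
      mul_inv_cancel_left₀ K.arc_real_bdry_pos.ne', sub_self]

theorem isProj_proj (K : SimplePolygon) (v : Plane → ℝ) : K.IsProj v (K.proj v) := by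
  rw [proj, dif_pos (K.exists_isProj v)]; exact (K.exists_isProj v).choose_spec

theorem isPoly_proj (K : SimplePolygon) (v : Plane → ℝ) : IsPoly 1 (K.proj v) := (K.isProj_proj v).1

theorem IsProj.unique {v π₁ π₂ : Plane → ℝ} (h₁ : K.IsProj v π₁) (h₂ : K.IsProj v π₂) :
    π₁ = π₂ := by
  obtain ⟨hp₁, hg₁, hb₁⟩ := h₁
  obtain ⟨hp₂, hg₂, hb₂⟩ := h₂
  obtain ⟨d₁, c₁, rfl⟩ := hp₁.eq_affine
  obtain ⟨d₂, c₂, rfl⟩ := hp₂.eq_affine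
  have e := (hg₁ _ (isPoly_affine (d₁ - d₂) 0)).trans (hg₂ _ (isPoly_affine (d₁ - d₂) 0)).symm
  rw [integral_inner_wgrad_affine, integral_inner_wgrad_affine, integral_wgrad_affine,
    integral_wgrad_affine, real_inner_smul_left, real_inner_smul_left] at e
  have e' := mul_left_cancel₀ K.volume_region_pos.ne' e
  rw [← sub_eq_zero, ← inner_sub_left, inner_self_eq_zero, sub_eq_zero] at e'
  subst e'
  rw [integral_sub (K.integrable_trace v) (K.integrable_bdry_of_isPoly hp₁)] at hb₁
  rw [integral_sub (K.integrable_trace v) (K.integrable_bdry_of_isPoly hp₂)] at hb₂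
  have hi := K.integrable_bdry_of_isPoly (isPoly_affine d₁ 0)
  simp only [add_zero] at hi
  rw [integral_add hi (integrable_const _), setIntegral_const, smul_eq_mul] at hb₁ hb₂
  have : c₁ = c₂ := mul_left_cancel₀ K.arc_real_bdry_pos.ne' (by linarith)
  rw [this]

theorem IsProj.proj_eq {v π : Plane → ℝ} (h : K.IsProj v π) : K.proj v = π :=
  (K.isProj_proj v).unique h

/-- The functions of `H¹(K)` that have a trace on `∂K`. -/
def HasTrace (K : SimplePolygon) (v : Plane → ℝ) : Prop := ∃ g, K.IsTrace v g

theorem HasTrace.memH1 {v : Plane → ℝ} (h : K.HasTrace v) : MemH1 K.region v := h.choose_spec.1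

theorem hasTrace_of_isPoly (K : SimplePolygon) {l : ℕ} {p : Plane → ℝ} (hp : IsPoly l p) :
    K.HasTrace p := ⟨p, K.isTrace_of_contDiff hp.contDiff⟩

theorem proj_linearComb (h : K.IsStarDisk z ρ) {u v : Plane → ℝ} (hu : K.HasTrace u)
    (hv : K.HasTrace v) (s t : ℝ) :
    K.proj (fun x => s * u x + t * v x) = fun x => s * K.proj u x + t * K.proj v x := by
  obtain ⟨pu, gu, bu⟩ := K.isProj_proj u
  obtain ⟨pv, gv, bv⟩ := K.isProj_proj v
  refine IsProj.proj_eq ⟨pu.linearComb pv s t, fun p hp => ?_, ?_⟩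
  · have e1 := gu p hp
    have e2 := gv p hp
    obtain ⟨d, c, rfl⟩ := hp.eq_affine
    rw [integral_inner_wgrad_affine, integral_inner_wgrad_affine] at e1 e2 ⊢
    have key : ∀ {f g : Plane → ℝ}, K.HasTrace f → K.HasTrace g →
        ∫ x in K.region, wgrad K.region (fun x => s * f x + t * g x) x =
          s • (∫ x in K.region, wgrad K.region f x) + t • ∫ x in K.region, wgrad K.region g x := by
      intro f g hf hg
      have i1 : Integrable (wgrad K.region f) (volume.restrict K.region) :=
        (memLp_wgrad _ f).integrable (by norm_num)
      have i2 : Integrable (wgrad K.region g) (volume.restrict K.region) :=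
        (memLp_wgrad _ g).integrable (by norm_num)
      rw [integral_congr_ae (wgrad_linearComb K.isOpen_region hf.memH1 hg.memH1 s t),
        integral_add (f := fun x => s • wgrad K.region f x) (g := fun x => t • wgrad K.region g x)
          (i1.smul s) (i2.smul t), integral_smul, integral_smul]
    rw [key hu hv, key (K.hasTrace_of_isPoly pu) (K.hasTrace_of_isPoly pv)]
    simp only [inner_add_left, real_inner_smul_left, e1, e2]
  · have ht := ((isTrace_trace hu).linearComb (isTrace_trace hv) s t).trace_ae_eq h
    have e : ∫ x in K.bdry, (K.trace (fun x => s * u x + t * v x) x -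
        (s * K.proj u x + t * K.proj v x)) ∂arc = ∫ x in K.bdry, (s * (K.trace u x - K.proj u x) +
          t * (K.trace v x - K.proj v x)) ∂arc := by
      refine integral_congr_ae ?_
      filter_upwards [ht] with x hx
      rw [hx]; ring
    rw [e, integral_linearComb (f := fun x => K.trace u x - K.proj u x)
      (g := fun x => K.trace v x - K.proj v x)
      ((K.integrable_trace u).sub (K.integrable_bdry_of_isPoly pu))
      ((K.integrable_trace v).sub (K.integrable_bdry_of_isPoly pv)), bu, bv]
    simp

theorem proj_of_isPoly (h : K.IsStarDisk z ρ) {p : Plane → ℝ} (hp : IsPoly 1 p) : K.proj p = p := by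
  refine IsProj.proj_eq ⟨hp, fun _ _ => rfl, ?_⟩
  rw [integral_congr_ae (g := fun _ => (0 : ℝ)), integral_zero]
  filter_upwards [(K.isTrace_of_contDiff hp.contDiff).trace_ae_eq h] with x hx
  rw [hx, sub_self]

theorem MemV1.hasTrace {v : Plane → ℝ} (hv : K.MemV1 v) : K.HasTrace v :=
  let ⟨_, ⟨g, _, hg⟩, _⟩ := hv
  ⟨g, hg⟩

theorem MemV1.linearComb {u v : Plane → ℝ} (hu : K.MemV1 u) (hv : K.MemV1 v) (s t : ℝ) :
    K.MemV1 fun x => s * u x + t * v x := by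
  obtain ⟨hu, ⟨g, hgB, hg⟩, q, hq, hqu⟩ := hu
  obtain ⟨hv, ⟨k, hkB, hk⟩, r, hr, hrv⟩ := hv
  refine ⟨hu.linearComb hv s t, ⟨_, ⟨(continuousOn_const.mul hgB.1).add
    (continuousOn_const.mul hkB.1), fun i => ?_⟩, hg.linearComb hk s t⟩, _, hq.linearComb hr s t,
    fun φ hφ hc hs => ?_⟩
  · obtain ⟨p, hp, hp'⟩ := hgB.2 i
    obtain ⟨p', hq, hq'⟩ := hkB.2 i
    exact ⟨_, hp.linearComb hq s t, fun x hx => by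
      change s * g x + t * k x = _
      rw [hp' hx, hq' hx]⟩
  · have hgφ : MemLp (gradient φ) 2 (volume.restrict K.region) :=
      memLp_of_continuous_of_isBounded (continuous_gradient (hφ.of_le (by simp))) K.isBounded_region
    have hφ2 : MemLp φ 2 (volume.restrict K.region) :=
      memLp_of_continuous_of_isBounded hφ.continuous K.isBounded_region
    have I : ∀ w : Plane → ℝ, Integrable (fun x =>
        (inner ℝ (wgrad K.region w x) (gradient φ x) : ℝ)) (volume.restrict K.region) :=
      fun w => integrable_inner_of_memLp (memLp_wgrad _ w) hgφ
    have e1 : ∫ x in K.region, inner ℝ (wgrad K.region (fun x => s * u x + t * v x) x)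
        (gradient φ x) = ∫ x in K.region, (s * inner ℝ (wgrad K.region u x) (gradient φ x) +
          t * inner ℝ (wgrad K.region v x) (gradient φ x)) := by
      refine integral_congr_ae ?_
      filter_upwards [wgrad_linearComb K.isOpen_region hu hv s t] with x hx
      rw [hx, inner_add_left, real_inner_smul_left, real_inner_smul_left]
    have e2 : ∀ x, (s * q x + t * r x) * φ x = s * (q x * φ x) + t * (r x * φ x) := fun x => by ring
    simp only [e2]
    rw [e1, integral_linearComb (I u) (I v), integral_linearComb
      (integrable_mul_of_memLp (K.memLp_of_isPoly hq) hφ2)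
      (integrable_mul_of_memLp (K.memLp_of_isPoly hr) hφ2), hqu φ hφ hc hs, hrv φ hφ hc hs]
    ring

theorem memV1_of_isPoly (K : SimplePolygon) {p : Plane → ℝ} (hp : IsPoly 1 p) : K.MemV1 p := by
  refine ⟨memH1_of_contDiff K.isBounded_region hp.contDiff,
    ⟨p, ⟨(hp.contDiff (n := 0)).continuous.continuousOn, fun i => ⟨p, hp, fun _ _ => rfl⟩⟩,
      K.isTrace_of_contDiff hp.contDiff⟩, fun _ => 0, isPoly_const 1 0, fun φ hφ hc hs => ?_⟩
  obtain ⟨d, c, rfl⟩ := hp.eq_affine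
  have e1 : ∫ x in K.region, inner ℝ (wgrad K.region (fun x => inner ℝ d x + c) x) (gradient φ x) =
      ∫ x in K.region, 1 * fderiv ℝ φ x d := by
    refine integral_congr_ae ?_
    filter_upwards [K.wgrad_affine d c] with x hx
    rw [hx, real_inner_comm, inner_gradient, one_mul]
  -- a derivative of a test function has mean value zero: the weak gradient of `1` is `0`
  have h1 := (isWeakGrad_gradient K.isBounded_region
    (contDiff_const (c := (1 : ℝ)) (n := 1))).2 φ hφ hc hs d
  rw [e1, h1]
  simp

/-! ### The local virtual element space -/

theorem MemW.hasTrace {v : Plane → ℝ} (hv : K.MemW v) : K.HasTrace v := hv.1.hasTrace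

theorem MemW.linearComb (h : K.IsStarDisk z ρ) {u v : Plane → ℝ} (hu : K.MemW u) (hv : K.MemW v)
    (s t : ℝ) : K.MemW fun x => s * u x + t * v x := by
  refine ⟨hu.1.linearComb hv.1 s t, fun q hq => ?_⟩
  rw [proj_linearComb h hu.hasTrace hv.hasTrace]
  have e : ∀ x, (s * u x + t * v x - (s * K.proj u x + t * K.proj v x)) * q x =
      s * ((u x - K.proj u x) * q x) + t * ((v x - K.proj v x) * q x) := fun x => by ring
  have I : ∀ {w : Plane → ℝ}, K.MemW w → Integrable (fun x => (w x - K.proj w x) * q x)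
      (volume.restrict K.region) := fun {w} hw =>
    (hw.1.1.1.sub (K.memLp_of_isPoly (K.isPoly_proj w))).integrable_mul (K.memLp_of_isPoly hq)
  simp only [e]
  rw [integral_linearComb (I hu) (I hv), hu.2 q hq, hv.2 q hq]
  simp

theorem memW_of_isPoly (h : K.IsStarDisk z ρ) {p : Plane → ℝ} (hp : IsPoly 1 p) : K.MemW p :=
  ⟨K.memV1_of_isPoly hp, fun q _ => by rw [proj_of_isPoly h hp]; simp⟩

theorem MemKer.linearComb (h : K.IsStarDisk z ρ) {u v : Plane → ℝ} (hu : K.MemKer u)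
    (hv : K.MemKer v) (s t : ℝ) : K.MemKer fun x => s * u x + t * v x := by
  refine ⟨hu.1.linearComb h hv.1 s t, ?_⟩
  rw [proj_linearComb h hu.1.hasTrace hv.1.hasTrace, hu.2, hv.2]
  funext x
  simp

theorem sub_proj_eq (K : SimplePolygon) (v : Plane → ℝ) :
    (fun x => v x - K.proj v x) = fun x => 1 * v x + -1 * K.proj v x :=
  funext fun x => by ring

theorem MemW.memKer_sub_proj (h : K.IsStarDisk z ρ) {v : Plane → ℝ} (hv : K.MemW v) :
    K.MemKer fun x => v x - K.proj v x := by
  have hp := K.isPoly_proj v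
  rw [sub_proj_eq]
  refine ⟨hv.linearComb h (memW_of_isPoly h hp) 1 (-1), ?_⟩
  rw [proj_linearComb h hv.hasTrace (K.hasTrace_of_isPoly hp), proj_of_isPoly h hp]
  funext x
  simp

/-! ### The local forms -/

theorem a_self (K : SimplePolygon) {v : Plane → ℝ} (hv : MemLp v 2 (volume.restrict K.region)) :
    K.a v v = K.sqGrad v + K.sqL2 v := by
  rw [a, sqGrad, sqL2, ← integral_add ((memLp_wgrad _ v).integrable_norm_pow (by norm_num))
    hv.integrable_sq]
  simp only [real_inner_self_eq_norm_sq, pow_two]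

theorem a_self_nonneg (K : SimplePolygon) (v : Plane → ℝ) : 0 ≤ K.a v v :=
  integral_nonneg fun _ => add_nonneg real_inner_self_nonneg (mul_self_nonneg _)

theorem a_linearComb_self {u v : Plane → ℝ} (hu : MemH1 K.region u) (hv : MemH1 K.region v)
    (s t : ℝ) : K.a (fun x => s * u x + t * v x) (fun x => s * u x + t * v x) =
      s ^ 2 * K.a u u + 2 * s * t * K.a u v + t ^ 2 * K.a v v := by
  have I : ∀ {f g : Plane → ℝ}, MemH1 K.region f → MemH1 K.region g → Integrable (fun x =>
      (inner ℝ (wgrad K.region f x) (wgrad K.region g x) : ℝ) + f x * g x)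
      (volume.restrict K.region) := fun {f g} hf hg =>
    (integrable_inner_of_memLp (memLp_wgrad _ f) (memLp_wgrad _ g)).add
      (integrable_mul_of_memLp hf.1 hg.1)
  simp only [a]
  have e := integral_linearComb
    (((I hu hu).const_mul (s ^ 2)).add ((I hu hv).const_mul (2 * s * t))) (I hv hv) 1 (t ^ 2)
  simp only [Pi.add_apply] at e
  rw [integral_linearComb (I hu hu) (I hu hv), one_mul] at e
  rw [← e]
  refine integral_congr_ae ?_
  filter_upwards [wgrad_linearComb K.isOpen_region hu hv s t] with x hx
  rw [hx]
  simp only [inner_add_left, inner_add_right, real_inner_smul_left, real_inner_smul_right]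
  rw [real_inner_comm (wgrad K.region u x) (wgrad K.region v x)]
  ring

theorem abs_a_le {u v : Plane → ℝ} (hu : MemH1 K.region u) (hv : MemH1 K.region v) :
    |K.a u v| ≤ √(K.a u u) * √(K.a v v) :=
  abs_le_sqrt_mul_sqrt fun s t => by
    rw [← a_linearComb_self hu hv]; exact K.a_self_nonneg _

/-- On `W(K)` the projection is orthogonal for both parts of `a^K`. -/
theorem MemW.a_eq_add {v : Plane → ℝ} (hv : K.MemW v) :
    K.a v v = K.a (K.proj v) (K.proj v) +
      K.a (fun x => v x - K.proj v x) (fun x => v x - K.proj v x) := by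
  have hp := K.isPoly_proj v
  have hpH := (K.hasTrace_of_isPoly hp).memH1
  have hvH := hv.1.1
  have key : K.a v (K.proj v) = K.a (K.proj v) (K.proj v) := by
    rw [a, a, integral_add (integrable_inner_of_memLp (memLp_wgrad _ _) (memLp_wgrad _ _))
      (integrable_mul_of_memLp hvH.1 hpH.1), integral_add
      (integrable_inner_of_memLp (memLp_wgrad _ _) (memLp_wgrad _ _))
      (integrable_mul_of_memLp hpH.1 hpH.1),
      ← (K.isProj_proj v).2.1 _ hp]
    congr 1
    have h0 := hv.2 _ hp
    simp only [sub_mul] at h0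
    rw [integral_sub (integrable_mul_of_memLp hvH.1 hpH.1)
      (integrable_mul_of_memLp hpH.1 hpH.1)] at h0
    linarith
  rw [sub_proj_eq, a_linearComb_self hvH hpH, key]
  ring

theorem MemW.a_proj_le {v : Plane → ℝ} (hv : K.MemW v) : K.a (K.proj v) (K.proj v) ≤ K.a v v := by
  have := K.a_self_nonneg fun x => v x - K.proj v x
  rw [hv.a_eq_add]
  linarith

theorem MemW.a_sub_proj_le {v : Plane → ℝ} (hv : K.MemW v) :
    K.a (fun x => v x - K.proj v x) (fun x => v x - K.proj v x) ≤ K.a v v := by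
  have := K.a_self_nonneg (K.proj v)
  rw [hv.a_eq_add]
  linarith

theorem MemW.sqGrad_proj_le {v : Plane → ℝ} (hv : K.MemW v) : K.sqGrad (K.proj v) ≤ K.a v v := by
  have hp := K.memLp_of_isPoly (K.isPoly_proj v)
  have h1 := hv.a_proj_le
  have h2 := sqL2_nonneg (K := K) (K.proj v)
  rw [K.a_self hp] at h1
  linarith

variable {cl cu : ℝ} {S : (Plane → ℝ) → (Plane → ℝ) → ℝ}

theorem IsStab.abs_le (hS : K.IsStab cl cu S) (hcl : 0 ≤ cl) (h : K.IsStarDisk z ρ)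
    {u v : Plane → ℝ} (hu : K.MemKer u) (hv : K.MemKer v) : |S u v| ≤ √(S u u) * √(S v v) :=
  abs_le_sqrt_mul_sqrt fun s t => by
    have hw := hu.linearComb h hv s t
    have h0 := (mul_nonneg hcl (K.a_self_nonneg _)).trans (hS.lower _ hw)
    rw [hS.linear s t u v _ hu hv hw, hS.symm _ _ hu hw, hS.symm _ _ hv hw,
      hS.linear s t u v _ hu hv hu, hS.linear s t u v _ hu hv hv, hS.symm v u hv hu] at h0
    linarith

theorem IsStab.min_mul_a_le_aStab (hS : K.IsStab cl cu S) (h : K.IsStarDisk z ρ)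
    {v : Plane → ℝ} (hv : K.MemW v) : min 1 cl * K.a v v ≤ K.aStab S v v := by
  have h1 := hS.lower _ (hv.memKer_sub_proj h)
  have h2 := K.a_self_nonneg (K.proj v)
  have h3 := K.a_self_nonneg fun x => v x - K.proj v x
  rw [aStab, hv.a_eq_add, mul_add]
  refine add_le_add ?_ (le_trans ?_ h1)
  · exact mul_le_of_le_one_left h2 (min_le_left _ _)
  · exact mul_le_mul_of_nonneg_right (min_le_right _ _) h3

theorem IsStab.abs_aStab_le (hS : K.IsStab cl cu S) (hcl : 0 ≤ cl) (hcu : 0 ≤ cu)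
    (h : K.IsStarDisk z ρ) {u v : Plane → ℝ} (hu : K.MemW u) (hv : K.MemW v) :
    |K.aStab S u v| ≤ (1 + cu) * (√(K.a u u) * √(K.a v v)) := by
  have h1 := abs_a_le (K.hasTrace_of_isPoly (K.isPoly_proj u)).memH1
    (K.hasTrace_of_isPoly (K.isPoly_proj v)).memH1
  have h2 := hS.abs_le hcl h (hu.memKer_sub_proj h) (hv.memKer_sub_proj h)
  have h3 : ∀ {w : Plane → ℝ}, K.MemW w →
      √(S (fun x => w x - K.proj w x) (fun x => w x - K.proj w x)) ≤ √cu * √(K.a w w) := by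
    intro w hw
    rw [← Real.sqrt_mul hcu]
    refine Real.sqrt_le_sqrt ((hS.upper _ (hw.memKer_sub_proj h)).trans ?_)
    exact mul_le_mul_of_nonneg_left hw.a_sub_proj_le hcu
  rw [aStab]
  calc _ ≤ √(K.a (K.proj u) (K.proj u)) * √(K.a (K.proj v) (K.proj v)) +
        √(S (fun x => u x - K.proj u x) (fun x => u x - K.proj u x)) *
        √(S (fun x => v x - K.proj v x) (fun x => v x - K.proj v x)) :=
        (abs_add_le _ _).trans (add_le_add h1 h2)
    _ ≤ √(K.a u u) * √(K.a v v) + (√cu * √(K.a u u)) * (√cu * √(K.a v v)) := by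
        gcongr
        · exact hu.a_proj_le
        · exact hv.a_proj_le
        · exact h3 hu
        · exact h3 hv
    _ = √(K.a u u) * √(K.a v v) + (√cu * √cu) * (√(K.a u u) * √(K.a v v)) := by ring
    _ = _ := by rw [Real.mul_self_sqrt hcu]; ring

end SimplePolygon

/-! ### Segments without nodes in their interior -/

/-- Two intervals of the line of which neither has an endpoint of the other in its interior agree
as soon as they share two points. -/
theorem eq_zero_and_eq_one_of_overlap {a b s t : ℝ} (hs : s ∈ Icc (0 : ℝ) 1)
    (ht : t ∈ Icc (0 : ℝ) 1) (hs' : s ∈ Icc a b) (ht' : t ∈ Icc a b) (hst : s ≠ t)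
    (ha : a ∉ Ioo (0 : ℝ) 1) (hb : b ∉ Ioo (0 : ℝ) 1) (h0 : (0 : ℝ) ∉ Ioo a b)
    (h1 : (1 : ℝ) ∉ Ioo a b) : a = 0 ∧ b = 1 := by
  simp only [mem_Ioo, mem_Icc, not_and, not_lt] at *
  rcases lt_or_gt_of_ne hst with h | h <;> constructor <;> by_contra hne <;>
    rcases lt_or_gt_of_ne hne with h' | h' <;> grind

theorem add_smul_mem_openSegment (p d : Plane) {a b r : ℝ} (hr : r ∈ Ioo a b) :
    p + r • d ∈ openSegment ℝ (p + a • d) (p + b • d) := by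
  have hab : 0 < b - a := by linarith [hr.1, hr.2]
  refine ⟨(b - r) / (b - a), (r - a) / (b - a), div_pos (by linarith [hr.2]) hab,
    div_pos (by linarith [hr.1]) hab, by field_simp; ring, ?_⟩
  have h1 : (b - r) / (b - a) + (r - a) / (b - a) = 1 := by field_simp; ring
  have h2 : (b - r) / (b - a) * a + (r - a) / (b - a) * b = r := by field_simp; ring
  calc _ = ((b - r) / (b - a) + (r - a) / (b - a)) • p +
        ((b - r) / (b - a) * a + (r - a) / (b - a) * b) • d := by
        simp only [smul_add, add_smul, smul_smul]; abel
    _ = _ := by rw [h1, h2, one_smul]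

/-- Two segments of which neither has an endpoint of the other in its interior agree as soon as they
share two points. -/
theorem segment_eq_or_inter_subsingleton {p q p' q' : Plane}
    (hp : p ∉ openSegment ℝ p' q') (hq : q ∉ openSegment ℝ p' q')
    (hp' : p' ∉ openSegment ℝ p q) (hq' : q' ∉ openSegment ℝ p q) :
    segment ℝ p q = segment ℝ p' q' ∨ (segment ℝ p q ∩ segment ℝ p' q').Subsingleton := by
  by_contra! hcon
  obtain ⟨hne, hsub⟩ := hcon
  obtain ⟨x, ⟨hx, hx'⟩, y, ⟨hy, hy'⟩, hxy⟩ := hsub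
  rw [segment_eq_image'] at hx hy hx' hy'
  obtain ⟨s, hs, rfl⟩ := hx
  obtain ⟨t, ht, rfl⟩ := hy
  obtain ⟨σ, hσ, hσx⟩ := hx'
  obtain ⟨τ, hτ, hτy⟩ := hy'
  simp only at hσx hτy hxy
  have hst : s ≠ t := fun h => hxy (by rw [h])
  have hστ : σ ≠ τ := fun h => hxy (by rw [← hσx, ← hτy, h])
  have hτσ : τ - σ ≠ 0 := sub_ne_zero.2 hστ.symm
  obtain ⟨κ, hκ⟩ : ∃ κ, κ = (t - s) / (τ - σ) := ⟨_, rfl⟩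
  have hκ' : κ * (τ - σ) = t - s := by rw [hκ, div_mul_cancel₀ _ hτσ]
  have hd : q' - p' = κ • (q - p) := by
    have h1 : (τ - σ) • (q' - p') = (t - s) • (q - p) := by
      rw [sub_smul, sub_smul]
      calc τ • (q' - p') - σ • (q' - p') = (p' + τ • (q' - p')) - (p' + σ • (q' - p')) := by abel
        _ = _ := by rw [hσx, hτy]; abel
    rw [hκ, div_eq_inv_mul, mul_smul, ← h1, inv_smul_smul₀ hτσ]
  -- `a` and `b` are the parameters of `p'` and `q'` on the line through `p` and `q`
  obtain ⟨a, ha⟩ : ∃ a, a = s - σ * κ := ⟨_, rfl⟩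
  have hpa : p' = p + a • (q - p) := by
    rw [hd, smul_smul] at hσx
    rw [ha, sub_smul, ← add_sub_assoc, ← hσx, add_sub_cancel_right]
  have hqb : q' = p + (a + κ) • (q - p) := by
    rw [add_smul, ← hd, ← add_assoc, ← hpa, add_sub_cancel]
  obtain ⟨b, hb⟩ : ∃ b, b = a + κ := ⟨_, rfl⟩
  rw [← hb] at hqb
  have hp0 : p + (0 : ℝ) • (q - p) = p := by rw [zero_smul, add_zero]
  have hq1 : p + (1 : ℝ) • (q - p) = q := by rw [one_smul, add_sub_cancel]
  have A : a ∉ Ioo (0 : ℝ) 1 := fun h => hp' (by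
    have := add_smul_mem_openSegment p (q - p) h
    rwa [hp0, hq1, ← hpa] at this)
  have B : b ∉ Ioo (0 : ℝ) 1 := fun h => hq' (by
    have := add_smul_mem_openSegment p (q - p) h
    rwa [hp0, hq1, ← hqb] at this)
  have hsa : s = a + σ * κ := by rw [ha]; ring
  have hta : t = a + τ * κ := by linarith
  rcases lt_or_ge 0 κ with hk | hk
  · have Z : (0 : ℝ) ∉ Ioo a b := fun h => hp (by
      have := add_smul_mem_openSegment p (q - p) h
      rwa [hp0, ← hpa, ← hqb] at this)
    have O : (1 : ℝ) ∉ Ioo a b := fun h => hq (by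
      have := add_smul_mem_openSegment p (q - p) h
      rwa [hq1, ← hpa, ← hqb] at this)
    obtain ⟨h0, h1⟩ := eq_zero_and_eq_one_of_overlap hs ht
      (a := a) (b := b) ⟨by nlinarith [hσ.1], by nlinarith [hσ.2]⟩
      ⟨by nlinarith [hτ.1], by nlinarith [hτ.2]⟩ hst A B Z O
    rw [h0, hp0] at hpa
    rw [h1, hq1] at hqb
    exact hne (by rw [hpa, hqb])
  · have Z : (0 : ℝ) ∉ Ioo b a := fun h => hp (by
      have := add_smul_mem_openSegment p (q - p) h
      rwa [hp0, ← hpa, ← hqb, openSegment_symm] at this)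
    have O : (1 : ℝ) ∉ Ioo b a := fun h => hq (by
      have := add_smul_mem_openSegment p (q - p) h
      rwa [hq1, ← hpa, ← hqb, openSegment_symm] at this)
    obtain ⟨h0, h1⟩ := eq_zero_and_eq_one_of_overlap hs ht
      (a := b) (b := a) ⟨by nlinarith [hσ.2], by nlinarith [hσ.1]⟩
      ⟨by nlinarith [hτ.2], by nlinarith [hτ.1]⟩ hst B A Z O
    rw [h1, hq1] at hpa
    rw [h0, hp0] at hqb
    exact hne (by rw [hpa, hqb, segment_symm])

/-! ### Integrals over edges -/

section L2

variable {α : Type*} [MeasurableSpace α] {μ : Measure α}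

theorem abs_integral_inner_le {f g : α → Plane} (hf : MemLp f 2 μ) (hg : MemLp g 2 μ) :
    |∫ x, inner ℝ (f x) (g x) ∂μ| ≤ √(∫ x, ‖f x‖ ^ 2 ∂μ) * √(∫ x, ‖g x‖ ^ 2 ∂μ) := by
  refine abs_le_sqrt_mul_sqrt fun s t => ?_
  have i1 := integrable_inner_of_memLp hf hf
  have i2 := integrable_inner_of_memLp hf hg
  have i3 := integrable_inner_of_memLp hg hg
  have e := integral_linearComb ((i1.const_mul (s ^ 2)).add (i2.const_mul (2 * s * t))) i3 1 (t ^ 2)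
  simp only [Pi.add_apply] at e
  rw [integral_linearComb i1 i2, one_mul] at e
  simp only [real_inner_self_eq_norm_sq] at e
  rw [← e]
  refine integral_nonneg fun x => ?_
  have h : (0 : ℝ) ≤ inner ℝ (s • f x + t • g x) (s • f x + t • g x) := real_inner_self_nonneg
  simp only [inner_add_left, inner_add_right, real_inner_smul_left, real_inner_smul_right] at h
  simp only [real_inner_self_eq_norm_sq] at h
  rw [real_inner_comm (f x) (g x)] at h
  simp only [Pi.zero_apply]
  linarith

theorem memLp_smul_const {f : α → ℝ} (hf : MemLp f 2 μ) (c : Plane) :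
    MemLp (fun x => f x • c) 2 μ :=
  (ContinuousLinearMap.toSpanSingleton ℝ c).comp_memLp' hf

end L2

namespace SimplePolygon

variable {K : SimplePolygon} {z : Plane} {ρ : ℝ}

theorem memLp_gradTrace (K : SimplePolygon) (v : Plane → ℝ) :
    MemLp (K.gradTrace v) 2 (arc.restrict K.bdry) := by
  have h : K.gradTrace v = fun x => ∑ i, K.trace (wpartial K.region i v) x •
      (EuclideanSpace.single i (1 : ℝ) : Plane) := by
    funext x
    ext j
    fin_cases j <;> simp [gradTrace]
  rw [h]
  exact memLp_finsetSum _ fun i _ => memLp_smul_const (K.memLp_trace _) _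

theorem integral_gradTrace (K : SimplePolygon) (v : Plane → ℝ) :
    ∫ x in K.bdry, ‖K.gradTrace v x‖ ^ 2 ∂arc =
      ∑ i, ∫ x in K.bdry, K.trace (wpartial K.region i v) x ^ 2 ∂arc := by
  rw [← integral_finsetSum _ fun i _ => (K.memLp_trace _).integrable_sq]
  refine integral_congr_ae (ae_of_all _ fun x => ?_)
  simp [EuclideanSpace.norm_sq_eq, gradTrace]

theorem sqGrad_eq_sum (K : SimplePolygon) (v : Plane → ℝ) :
    K.sqGrad v = ∑ i, K.sqL2 (wpartial K.region i v) := by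
  simp only [sqGrad, sqL2]
  have hi : ∀ i ∈ Finset.univ, Integrable (fun x => wpartial K.region i v x ^ 2)
      (volume.restrict K.region) := fun i _ => (memLp_apply (memLp_wgrad _ v) i).integrable_sq
  rw [← integral_finsetSum _ hi]
  refine integral_congr_ae (ae_of_all _ fun x => ?_)
  simp [EuclideanSpace.norm_sq_eq, wpartial]

theorem IsStarDisk.diam_mul_integral_gradTrace_le (h : K.IsStarDisk z ρ) {γ : ℝ} (hγ : 0 < γ)
    (hρ : γ * K.diam ≤ ρ) (v : Plane → ℝ) :
    K.diam * ∫ x in K.bdry, ‖K.gradTrace v x‖ ^ 2 ∂arc ≤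
      6 * (K.m + 3 : ℕ) / γ * (K.sqGrad v + K.diam ^ 2 * K.sqHess v) := by
  rw [integral_gradTrace, sqGrad_eq_sum, sqHess, Finset.mul_sum, Finset.mul_sum,
    ← Finset.sum_add_distrib, Finset.mul_sum]
  exact Finset.sum_le_sum fun i _ => h.diam_mul_integral_trace_le hγ hρ _

/-- The inverse inequality `h² |∇v|²_{1,K} ≤ C ‖∇v‖²_{0,K}` for polynomials. -/
theorem exists_sqHess_le (l : ℕ) {γ : ℝ} (hγ : 0 < γ) : ∃ C : ℝ, 0 < C ∧
    ∀ (K : SimplePolygon) (z : Plane) (ρ : ℝ), K.IsStarDisk z ρ → γ * K.diam ≤ ρ →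
      ∀ v p : Plane → ℝ, IsPoly l p → v =ᵐ[volume.restrict K.region] p →
        K.diam ^ 2 * K.sqHess v ≤ C * K.sqGrad v := by
  obtain ⟨C, hC, hle⟩ := exists_sq_gradient_le (l - 1) hγ
  refine ⟨C, hC, fun K z ρ h hρ v p hp hv => ?_⟩
  rw [sqHess, sqGrad_eq_sum, Finset.mul_sum, Finset.mul_sum]
  refine Finset.sum_le_sum fun i _ => ?_
  have hpi := hp.gradient_apply i
  have h1 : wgrad K.region v =ᵐ[volume.restrict K.region] gradient p :=
    wgrad_ae_eq K.isOpen_region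
      ((isWeakGrad_gradient K.isBounded_region hp.contDiff).congr hv.symm)
  have h2 : wpartial K.region i v =ᵐ[volume.restrict K.region] fun x => gradient p x i := by
    filter_upwards [h1] with x hx
    rw [wpartial, hx]
  have h3 : wgrad K.region (wpartial K.region i v) =ᵐ[volume.restrict K.region]
      gradient fun x => gradient p x i :=
    wgrad_ae_eq K.isOpen_region
      ((isWeakGrad_gradient K.isBounded_region hpi.contDiff).congr h2.symm)
  have e1 : K.sqGrad (wpartial K.region i v) =
      ∫ x in K.region, ‖gradient (fun x => gradient p x i) x‖ ^ 2 := by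
    refine integral_congr_ae ?_
    filter_upwards [h3] with x hx
    rw [hx]
  have e2 : K.sqL2 (wpartial K.region i v) = ∫ x in K.region, gradient p x i ^ 2 := by
    refine integral_congr_ae ?_
    filter_upwards [h2] with x hx
    rw [hx]
  rw [e1, e2]
  exact hle K.region z ρ K.diam K.measurableSet_region K.diam_pos hρ h.ball_subset_region
    h.region_subset_closedBall _ hpi

end SimplePolygon

namespace Decomposition

variable {Ω : Set Plane} {T : Decomposition Ω} {e : Set Plane}

theorem mem_edges : e ∈ T.edges ↔ e ∈ T.edgeSet := Set.Finite.mem_toFinset _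

theorem mem_adj {K : SimplePolygon} : K ∈ T.adj e ↔ K ∈ T.elements ∧ ∃ i, e ⊆ K.side i := by
  classical
  simp [adj]

theorem subset_bdry_of_mem_adj {K : SimplePolygon} (hK : K ∈ T.adj e) : e ⊆ K.bdry :=
  let ⟨_, i, hi⟩ := mem_adj.1 hK
  hi.trans (K.side_subset_bdry i)

theorem measurableSet_of_mem_edges (he : e ∈ T.edges) : MeasurableSet e := by
  obtain ⟨p, -, q, -, -, rfl, -⟩ := mem_edges.1 he
  rw [← convexHull_pair]
  exact ((toFinite _).isCompact_convexHull ℝ).measurableSet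

theorem arc_real_pos (he : e ∈ T.edges) : 0 < arc.real e := by
  obtain ⟨p, -, q, -, hpq, rfl, -⟩ := mem_edges.1 he
  rw [Measure.real, hausdorffMeasure_segment, edist_dist, ENNReal.toReal_ofReal dist_nonneg]
  exact dist_pos.2 hpq

theorem arc_real_le_diam (he : e ∈ T.edges) {K : SimplePolygon} (hK : K ∈ T.adj e) :
    arc.real e ≤ K.diam := by
  have hsub := (subset_bdry_of_mem_adj hK).trans K.bdry_subset
  obtain ⟨p, -, q, -, hpq, rfl, -⟩ := mem_edges.1 he
  rw [Measure.real, hausdorffMeasure_segment, edist_dist, ENNReal.toReal_ofReal dist_nonneg]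
  exact K.dist_le_diam (hsub (left_mem_segment ℝ _ _)) (hsub (right_mem_segment ℝ _ _))

/-- Distinct edges have at most one common point, since no node lies inside an edge. -/
theorem aedisjoint_edges : (T.edges : Set (Set Plane)).Pairwise (AEDisjoint arc) := by
  intro e he e' he' hne
  obtain ⟨p, hp, q, hq, -, rfl, -, hn⟩ := mem_edges.1 he
  obtain ⟨p', hp', q', hq', -, rfl, -, hn'⟩ := mem_edges.1 he'
  have h := (segment_eq_or_inter_subsingleton (hn' p hp) (hn' q hq) (hn p' hp')
    (hn q' hq')).resolve_left hne
  have : NullSingletonClass arc := Measure.nullSingletonClass_hausdorff Plane one_pos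
  exact h.measure_zero arc

/-- The edges on the sides of `K` may be arbitrarily many, but they overlap in null sets only. -/
theorem sum_integral_edges_le (K : SimplePolygon) {f : Plane → ℝ} (hf : ∀ x, 0 ≤ f x)
    (hi : IntegrableOn f K.bdry arc) (s : Finset (Set Plane)) (hs : s ⊆ T.edges)
    (hK : ∀ e ∈ s, K ∈ T.adj e) : ∑ e ∈ s, ∫ x in e, f x ∂arc ≤ ∫ x in K.bdry, f x ∂arc := by
  have hsub : ∀ e ∈ s, e ⊆ K.bdry := fun e he => subset_bdry_of_mem_adj (hK e he)
  have h1 : ∀ e ∈ s, ENNReal.ofReal (∫ x in e, f x ∂arc) = ∫⁻ x in e, ENNReal.ofReal (f x) ∂arc :=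
    fun e he => ofReal_integral_eq_lintegral_ofReal (hi.mono_set (hsub e he)) (ae_of_all _ hf)
  rw [← ENNReal.ofReal_le_ofReal_iff (integral_nonneg hf),
    ENNReal.ofReal_sum_of_nonneg fun e _ => integral_nonneg hf, Finset.sum_congr rfl h1,
    ofReal_integral_eq_lintegral_ofReal hi (ae_of_all _ hf),
    ← lintegral_biUnion_finset₀ (fun e he e' he' => aedisjoint_edges (hs he) (hs he'))
      (fun e he => (measurableSet_of_mem_edges (hs he)).nullMeasurableSet)]
  exact lintegral_mono_set (iUnion₂_subset hsub)

theorem memLp_jump (T : Decomposition Ω) (v : Plane → ℝ) (e : Set Plane) :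
    MemLp (T.jump v e) 2 (arc.restrict e) :=
  memLp_finsetSum _ fun K hK => (memLp_smul_const (K.memLp_trace v) (K.normal e)).mono_measure
    (Measure.restrict_mono (subset_bdry_of_mem_adj hK) le_rfl)

theorem memLp_avgGrad (T : Decomposition Ω) (v : Plane → ℝ) (e : Set Plane) :
    MemLp (T.avgGrad v e) 2 (arc.restrict e) := by
  have h : MemLp (fun x => ∑ K ∈ T.adj e, K.gradTrace v x) 2 (arc.restrict e) :=
    memLp_finsetSum _ fun K hK => (K.memLp_gradTrace v).mono_measure
      (Measure.restrict_mono (subset_bdry_of_mem_adj hK) le_rfl)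
  exact h.const_smul ((T.adj e).card : ℝ)⁻¹

theorem norm_avgGrad_sq_le (T : Decomposition Ω) (v : Plane → ℝ) (e : Set Plane) (x : Plane) :
    ‖T.avgGrad v e x‖ ^ 2 ≤ ∑ K ∈ T.adj e, ‖K.gradTrace v x‖ ^ 2 := by
  set n : ℝ := ((T.adj e).card : ℝ) with hn
  have h0 : 0 ≤ ∑ K ∈ T.adj e, ‖K.gradTrace v x‖ ^ 2 := Finset.sum_nonneg fun _ _ => by positivity
  rcases (Nat.eq_zero_or_pos (T.adj e).card) with hc | hc
  · simp [avgGrad, hc, h0]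
  have hn1 : 1 ≤ n := by rw [hn]; exact_mod_cast hc
  have h1 : ‖∑ K ∈ T.adj e, K.gradTrace v x‖ ^ 2 ≤ n * ∑ K ∈ T.adj e, ‖K.gradTrace v x‖ ^ 2 :=
    (pow_le_pow_left₀ (norm_nonneg _) (norm_sum_le _ _) 2).trans sq_sum_le_card_mul_sum_sq
  rw [avgGrad, ← hn, norm_smul, mul_pow, norm_inv, Real.norm_of_nonneg (by linarith)]
  calc _ ≤ n⁻¹ ^ 2 * (n * ∑ K ∈ T.adj e, ‖K.gradTrace v x‖ ^ 2) := by gcongr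
    _ = n⁻¹ * ∑ K ∈ T.adj e, ‖K.gradTrace v x‖ ^ 2 := by field_simp
    _ ≤ _ := mul_le_of_le_one_left h0 (inv_le_one_of_one_le₀ hn1)

theorem integral_avgGrad_le (he : e ∈ T.edges) (v : Plane → ℝ) :
    arc.real e * ∫ x in e, ‖T.avgGrad v e x‖ ^ 2 ∂arc ≤
      ∑ K ∈ T.adj e, K.diam * ∫ x in e, ‖K.gradTrace v x‖ ^ 2 ∂arc := by
  have hi : ∀ K ∈ T.adj e, IntegrableOn (fun x => ‖K.gradTrace v x‖ ^ 2) e arc := fun K hK =>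
    ((K.memLp_gradTrace v).integrable_norm_pow (by norm_num)).mono_measure
      (Measure.restrict_mono (subset_bdry_of_mem_adj hK) le_rfl)
  calc _ ≤ arc.real e * ∫ x in e, ∑ K ∈ T.adj e, ‖K.gradTrace v x‖ ^ 2 ∂arc := by
        refine mul_le_mul_of_nonneg_left (integral_mono ?_ (integrable_finsetSum _ hi)
          fun x => T.norm_avgGrad_sq_le v e x) measureReal_nonneg
        exact (T.memLp_avgGrad v e).integrable_norm_pow (by norm_num)
    _ = ∑ K ∈ T.adj e, arc.real e * ∫ x in e, ‖K.gradTrace v x‖ ^ 2 ∂arc := by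
        rw [integral_finsetSum _ hi, Finset.mul_sum]
    _ ≤ _ := Finset.sum_le_sum fun K hK => by
        gcongr
        exact arc_real_le_diam he hK

theorem sum_integral_avgGrad_le (T : Decomposition Ω) (v : Plane → ℝ) :
    ∑ e ∈ T.edges, arc.real e * ∫ x in e, ‖T.avgGrad v e x‖ ^ 2 ∂arc ≤
      ∑ K ∈ T.elements, K.diam * ∫ x in K.bdry, ‖K.gradTrace v x‖ ^ 2 ∂arc := by
  classical
  calc _ ≤ ∑ e ∈ T.edges, ∑ K ∈ T.adj e, K.diam * ∫ x in e, ‖K.gradTrace v x‖ ^ 2 ∂arc :=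
        Finset.sum_le_sum fun e he => integral_avgGrad_le he v
    _ = ∑ K ∈ T.elements, ∑ e ∈ T.edges with K ∈ T.adj e,
          K.diam * ∫ x in e, ‖K.gradTrace v x‖ ^ 2 ∂arc :=
        Finset.sum_comm' fun e K => by
          simp only [Finset.mem_filter, mem_adj]
          tauto
    _ ≤ _ := Finset.sum_le_sum fun K _ => by
        rw [← Finset.mul_sum]
        have := K.diam_pos
        gcongr
        exact sum_integral_edges_le K (fun x => by positivity)
          ((K.memLp_gradTrace v).integrable_norm_pow (by norm_num)) _ (Finset.filter_subset _ _)
          fun e he => (Finset.mem_filter.1 he).2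

theorem jumpJump_self_eq (T : Decomposition Ω) (v : Plane → ℝ) :
    T.jumpJump v v = ∑ e ∈ T.edges, (arc.real e)⁻¹ * ∫ x in e, ‖T.jump v e x‖ ^ 2 ∂arc := by
  simp only [jumpJump, real_inner_self_eq_norm_sq, one_div]

theorem jumpJump_self_nonneg (T : Decomposition Ω) (v : Plane → ℝ) : 0 ≤ T.jumpJump v v := by
  rw [jumpJump_self_eq]
  exact Finset.sum_nonneg fun e _ => mul_nonneg (inv_nonneg.2 measureReal_nonneg)
    (integral_nonneg fun _ => by positivity)

theorem abs_jumpJump_le (T : Decomposition Ω) (v w : Plane → ℝ) :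
    |T.jumpJump v w| ≤ √(T.jumpJump v v) * √(T.jumpJump w w) := by
  have hn : ∀ (u : Plane → ℝ) (e : Set Plane),
      0 ≤ (arc.real e)⁻¹ * ∫ x in e, ‖T.jump u e x‖ ^ 2 ∂arc := fun u e =>
    mul_nonneg (inv_nonneg.2 measureReal_nonneg) (integral_nonneg fun _ => by positivity)
  rw [jumpJump_self_eq, jumpJump_self_eq]
  refine le_trans ?_ (Real.sum_sqrt_mul_sqrt_le _ (hn v) (hn w))
  refine (Finset.abs_sum_le_sum_abs _ _).trans (Finset.sum_le_sum fun e _ => ?_)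
  have hr : 0 ≤ (arc.real e)⁻¹ := inv_nonneg.2 measureReal_nonneg
  rw [Real.sqrt_mul hr, Real.sqrt_mul hr, one_div, abs_mul, abs_of_nonneg hr]
  calc _ ≤ (arc.real e)⁻¹ * (√(∫ x in e, ‖T.jump v e x‖ ^ 2 ∂arc) *
        √(∫ x in e, ‖T.jump w e x‖ ^ 2 ∂arc)) := by
        gcongr
        exact abs_integral_inner_le (T.memLp_jump v e) (T.memLp_jump w e)
    _ = (√(arc.real e)⁻¹ * √(arc.real e)⁻¹) * (√(∫ x in e, ‖T.jump v e x‖ ^ 2 ∂arc) *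
        √(∫ x in e, ‖T.jump w e x‖ ^ 2 ∂arc)) := by rw [Real.mul_self_sqrt hr]
    _ = _ := by ring

/-- The edge lengths are split evenly between the two factors; this is where the weights `1 / |e|`
of the jump form enter. -/
theorem abs_fluxJump_le (T : Decomposition Ω) {E : Finset (Set Plane)} (hE : E ⊆ T.edges)
    (v w : Plane → ℝ) : |T.fluxJump E v w| ≤
      √(∑ K ∈ T.elements, K.diam * ∫ x in K.bdry, ‖K.gradTrace v x‖ ^ 2 ∂arc) *
        √(T.jumpJump w w) := by
  have hn : ∀ e, 0 ≤ arc.real e * ∫ x in e, ‖T.avgGrad v e x‖ ^ 2 ∂arc := fun e =>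
    mul_nonneg measureReal_nonneg (integral_nonneg fun _ => by positivity)
  have hn' : ∀ e, 0 ≤ (arc.real e)⁻¹ * ∫ x in e, ‖T.jump w e x‖ ^ 2 ∂arc := fun e =>
    mul_nonneg (inv_nonneg.2 measureReal_nonneg) (integral_nonneg fun _ => by positivity)
  have h1 : |T.fluxJump E v w| ≤ ∑ e ∈ E, √(arc.real e * ∫ x in e, ‖T.avgGrad v e x‖ ^ 2 ∂arc) *
      √((arc.real e)⁻¹ * ∫ x in e, ‖T.jump w e x‖ ^ 2 ∂arc) := by
    refine (Finset.abs_sum_le_sum_abs _ _).trans (Finset.sum_le_sum fun e he => ?_)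
    have hpos := arc_real_pos (hE he)
    refine (abs_integral_inner_le (T.memLp_avgGrad v e) (T.memLp_jump w e)).trans_eq ?_
    have hs : √(arc.real e) * √(arc.real e)⁻¹ = 1 := by
      rw [← Real.sqrt_mul hpos.le, mul_inv_cancel₀ hpos.ne', Real.sqrt_one]
    rw [Real.sqrt_mul hpos.le, Real.sqrt_mul (inv_nonneg.2 hpos.le)]
    calc _ = (√(arc.real e) * √(arc.real e)⁻¹) * (√(∫ x in e, ‖T.avgGrad v e x‖ ^ 2 ∂arc) *
          √(∫ x in e, ‖T.jump w e x‖ ^ 2 ∂arc)) := by rw [hs, one_mul]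
      _ = _ := by ring
  refine h1.trans ((Real.sum_sqrt_mul_sqrt_le _ hn hn').trans ?_)
  rw [jumpJump_self_eq]
  gcongr
  exact (Finset.sum_le_sum_of_subset_of_nonneg hE fun e _ _ => hn e).trans
    (T.sum_integral_avgGrad_le v)

end Decomposition

theorem SimplePolygon.sqGrad_congr {K : SimplePolygon} {u v : Plane → ℝ} (hv : MemH1 K.region v)
    (h : u =ᵐ[volume.restrict K.region] v) : K.sqGrad u = K.sqGrad v := by
  refine integral_congr_ae ?_
  filter_upwards [wgrad_ae_eq K.isOpen_region (hv.isWeakGrad.congr h.symm)] with x hx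
  rw [hx]

namespace Decomposition

variable {Ω : Set Plane} {T : Decomposition Ω}

/-! ### Estimates uniform in the decomposition -/

/-- All elements have as many sides as the reference polygon. -/
theorem C0.m_eq {Khat K : SimplePolygon} (h : T.C0 Khat) (hK : K ∈ T.elements) :
    K.m = Khat.m := by
  obtain ⟨F, -, hF⟩ := h K hK
  have hcard : ∀ L : SimplePolygon, (range L.vertex).ncard = L.m + 3 := fun L => by
    rw [← Nat.card_coe_set_eq, Nat.card_range_of_injective L.vertex_injective, Nat.card_fin]
  have h1 := ncard_image_of_injective (range Khat.vertex) F.injective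
  rw [hF, hcard, hcard] at h1
  omega

theorem C1.exists_isStarDisk {γ : ℝ} (hγ : 0 < γ) (h : T.C1 γ) {K : SimplePolygon}
    (hK : K ∈ T.elements) : ∃ z ρ, K.IsStarDisk z ρ ∧ γ * K.diam ≤ ρ :=
  let ⟨z, ρ, hρ, hb, hs⟩ := h K hK
  ⟨z, ρ, ⟨(mul_pos hγ K.diam_pos).trans_le hρ, hb, hs⟩, hρ⟩

theorem abs_fluxJump_le_of_shape {Khat : SimplePolygon} {γ : ℝ} (hγ : 0 < γ) (h0 : T.C0 Khat)
    (h1 : T.C1 γ) {E : Finset (Set Plane)} (hE : E ⊆ T.edges) (v w : Plane → ℝ) :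
    |T.fluxJump E v w| ≤ √(6 * (Khat.m + 3 : ℕ) / γ) *
      √(∑ K ∈ T.elements, (K.sqGrad v + K.diam ^ 2 * K.sqHess v)) * √(T.jumpJump w w) := by
  refine (T.abs_fluxJump_le hE v w).trans ?_
  rw [← Real.sqrt_mul (show 0 ≤ 6 * ((Khat.m + 3 : ℕ) : ℝ) / γ by positivity), Finset.mul_sum]
  refine mul_le_mul_of_nonneg_right (Real.sqrt_le_sqrt (Finset.sum_le_sum fun K hK => ?_))
    (Real.sqrt_nonneg _)
  obtain ⟨z, ρ, hs, hρ⟩ := h1.exists_isStarDisk hγ hK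
  rw [← h0.m_eq hK]
  exact hs.diam_mul_integral_gradTrace_le hγ hρ v

/-- For piecewise polynomials the gradient seminorm alone bounds the flux. -/
theorem exists_abs_fluxJump_le (Khat : SimplePolygon) {γ : ℝ} (hγ : 0 < γ) (l : ℕ) :
    ∃ C : ℝ, 0 < C ∧ ∀ (Ω : Set Plane) (T : Decomposition Ω), T.C0 Khat → T.C1 γ →
      ∀ E ⊆ T.edges, ∀ v w : Plane → ℝ, T.IsPiecewisePoly l v →
        |T.fluxJump E v w| ≤ C * √(∑ K ∈ T.elements, K.sqGrad v) * √(T.jumpJump w w) := by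
  obtain ⟨C, hC, hle⟩ := SimplePolygon.exists_sqHess_le l hγ
  refine ⟨√(6 * (Khat.m + 3 : ℕ) / γ) * √(1 + C), by positivity,
    fun Ω T h0 h1 E hE v w hv => (abs_fluxJump_le_of_shape hγ h0 h1 hE v w).trans ?_⟩
  rw [mul_assoc √(6 * (Khat.m + 3 : ℕ) / γ) √(1 + C),
    ← Real.sqrt_mul (show 0 ≤ 1 + C by positivity), Finset.mul_sum]
  gcongr with K hK
  obtain ⟨z, ρ, hs, hρ⟩ := h1.exists_isStarDisk hγ hK
  obtain ⟨p, hp, hvp⟩ := hv K hK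
  have := hle K z ρ hs hρ v p hp hvp
  linarith

/-- The square of the broken `H¹` norm. -/
def energy (T : Decomposition Ω) (v : Plane → ℝ) : ℝ := ∑ K ∈ T.elements, (K.sqGrad v + K.sqL2 v)

theorem energy_nonneg (T : Decomposition Ω) (v : Plane → ℝ) : 0 ≤ T.energy v :=
  Finset.sum_nonneg fun _ _ =>
    add_nonneg (SimplePolygon.sqGrad_nonneg v) (SimplePolygon.sqL2_nonneg v)

theorem norm1_sq (T : Decomposition Ω) (v : Plane → ℝ) :
    T.norm1 v ^ 2 = T.energy v + T.jumpJump v v :=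
  Real.sq_sqrt (add_nonneg (T.energy_nonneg v) (T.jumpJump_self_nonneg v))

theorem sqrt_jumpJump_le_norm1 (T : Decomposition Ω) (v : Plane → ℝ) :
    √(T.jumpJump v v) ≤ T.norm1 v :=
  Real.sqrt_le_sqrt (le_add_of_nonneg_left (T.energy_nonneg v))

theorem sqrt_energy_le_norm1 (T : Decomposition Ω) (v : Plane → ℝ) : √(T.energy v) ≤ T.norm1 v :=
  Real.sqrt_le_sqrt (le_add_of_nonneg_right (T.jumpJump_self_nonneg v))

theorem sqrt_sqGrad_le_norm1 (T : Decomposition Ω) (v : Plane → ℝ) :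
    √(∑ K ∈ T.elements, K.sqGrad v) ≤ T.norm1 v :=
  (Real.sqrt_le_sqrt (Finset.sum_le_sum fun _ _ =>
    le_add_of_nonneg_right (SimplePolygon.sqL2_nonneg v))).trans (T.sqrt_energy_le_norm1 v)

theorem norm1_nonneg (T : Decomposition Ω) (v : Plane → ℝ) : 0 ≤ T.norm1 v := Real.sqrt_nonneg _

theorem sqrt_sqGrad_add_sqHess_le_norm2 (T : Decomposition Ω) (v : Plane → ℝ) :
    √(∑ K ∈ T.elements, (K.sqGrad v + K.diam ^ 2 * K.sqHess v)) ≤ T.norm2 v := by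
  refine Real.sqrt_le_sqrt ((Finset.sum_le_sum fun _ _ => ?_).trans
    (le_add_of_nonneg_right (T.jumpJump_self_nonneg v)))
  exact le_add_of_nonneg_right (SimplePolygon.sqL2_nonneg v)

theorem MemWDG.energy_eq {v : Plane → ℝ} (hv : T.MemWDG v) :
    T.energy v = ∑ K ∈ T.elements, K.a v v :=
  Finset.sum_congr rfl fun K hK => (K.a_self (hv.2 K hK).1.1.1).symm

theorem proj_eq_of_mem {K : SimplePolygon} (hK : K ∈ T.elements) (v : Plane → ℝ) {x : Plane}
    (hx : x ∈ K.region) : T.proj v x = K.proj v x := by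
  rw [proj, Finset.sum_eq_single K (fun L hL hLK => ?_) (fun h => absurd hK h),
    indicator_of_mem hx]
  exact indicator_of_notMem (fun hxL => disjoint_left.1 (T.disjoint L hL K hK hLK) hxL hx) _

theorem proj_ae_eq {K : SimplePolygon} (hK : K ∈ T.elements) (v : Plane → ℝ) :
    T.proj v =ᵐ[volume.restrict K.region] K.proj v :=
  (ae_restrict_mem K.measurableSet_region).mono fun _ hx => proj_eq_of_mem hK v hx

theorem isPiecewisePoly_proj (T : Decomposition Ω) (v : Plane → ℝ) :
    T.IsPiecewisePoly 1 (T.proj v) :=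
  fun K hK => ⟨_, K.isPoly_proj v, proj_ae_eq hK v⟩

theorem MemWDG.sum_sqGrad_proj_le {v : Plane → ℝ} (hv : T.MemWDG v) :
    ∑ K ∈ T.elements, K.sqGrad (T.proj v) ≤ T.energy v := by
  rw [hv.energy_eq]
  refine Finset.sum_le_sum fun K hK => ?_
  rw [SimplePolygon.sqGrad_congr (K.hasTrace_of_isPoly (K.isPoly_proj v)).memH1 (proj_ae_eq hK v)]
  exact (hv.2 K hK).sqGrad_proj_le

variable {cl cu γ : ℝ} {S : SimplePolygon → (Plane → ℝ) → (Plane → ℝ) → ℝ}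

theorem MemWDG.min_mul_energy_le (hγ : 0 < γ) (h1 : T.C1 γ) (hS : T.IsStab cl cu S)
    {v : Plane → ℝ} (hv : T.MemWDG v) : min 1 cl * T.energy v ≤ T.aStab S v v := by
  rw [hv.energy_eq, Finset.mul_sum]
  refine Finset.sum_le_sum fun K hK => ?_
  obtain ⟨z, ρ, hs, -⟩ := h1.exists_isStarDisk hγ hK
  exact (hS K hK).min_mul_a_le_aStab hs (hv.2 K hK)

theorem MemWDG.abs_aStab_le (hγ : 0 < γ) (h1 : T.C1 γ) (hS : T.IsStab cl cu S) (hcl : 0 ≤ cl)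
    (hcu : 0 ≤ cu) {v w : Plane → ℝ} (hv : T.MemWDG v) (hw : T.MemWDG w) :
    |T.aStab S v w| ≤ (1 + cu) * (√(T.energy v) * √(T.energy w)) := by
  have hc : 0 ≤ 1 + cu := by linarith
  rw [hv.energy_eq, hw.energy_eq]
  calc _ ≤ ∑ K ∈ T.elements, (1 + cu) * (√(K.a v v) * √(K.a w w)) := by
        refine (Finset.abs_sum_le_sum_abs _ _).trans (Finset.sum_le_sum fun K hK => ?_)
        obtain ⟨z, ρ, hs, -⟩ := h1.exists_isStarDisk hγ hK
        exact (hS K hK).abs_aStab_le hcl hcu hs (hv.2 K hK) (hw.2 K hK)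
    _ ≤ _ := by
        rw [← Finset.mul_sum]
        gcongr
        exact Real.sum_sqrt_mul_sqrt_le _ (fun K => K.a_self_nonneg v) fun K => K.a_self_nonneg w

/-- Young's inequality absorbs the flux terms of `B_h` into the energy and the penalty. -/
theorem MemWDG.le_B (hγ : 0 < γ) (h1 : T.C1 γ) (hcl : 0 < cl) (hS : T.IsStab cl cu S) {C δ η : ℝ}
    (hδ : |1 + δ| ≤ 2) {v : Plane → ℝ} (hv : T.MemWDG v)
    (hC : |T.fluxJump T.innerEdges (T.proj v) v| ≤ C * √(T.energy v) * √(T.jumpJump v v))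
    (hη : 2 * C ^ 2 / min 1 cl + min 1 cl / 2 ≤ η) :
    min 1 cl / 2 * T.norm1 v ^ 2 ≤ T.B S δ η v v := by
  set α := min 1 cl
  have hα : 0 < α := lt_min one_pos hcl
  have hA := hv.min_mul_energy_le hγ h1 hS
  have hE0 := T.energy_nonneg v
  have hJ0 := T.jumpJump_self_nonneg v
  set A := √(T.energy v)
  set J := √(T.jumpJump v v)
  have hA2 : T.energy v = A ^ 2 := (Real.sq_sqrt hE0).symm
  have hJ2 : T.jumpJump v v = J ^ 2 := (Real.sq_sqrt hJ0).symm
  set f := T.fluxJump T.innerEdges (T.proj v) v with hf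
  have hflux : (1 + δ) * f ≤ 2 * (C * A * J) :=
    calc (1 + δ) * f ≤ |1 + δ| * |f| := by rw [← abs_mul]; exact le_abs_self _
      _ ≤ 2 * (C * A * J) := mul_le_mul hδ hC (abs_nonneg _) zero_le_two
  have hyoung : 2 * (C * A * J) ≤ α / 2 * A ^ 2 + 2 * C ^ 2 / α * J ^ 2 := by
    have h0 : 0 ≤ (α * A - 2 * C * J) ^ 2 / (2 * α) := by positivity
    have e : (α * A - 2 * C * J) ^ 2 / (2 * α) =
        α / 2 * A ^ 2 + 2 * C ^ 2 / α * J ^ 2 - 2 * (C * A * J) := by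
      field_simp; ring
    linarith
  have hpen := mul_le_mul_of_nonneg_right hη (sq_nonneg J)
  rw [norm1_sq, B, ← hf, hJ2, hA2]
  rw [hA2] at hA
  nlinarith

end Decomposition

end DGVEM

end

theorem lemma5 (Khat : SimplePolygon) (γ₁ γ₂ cl cu : ℝ)
    (hγ₁ : 0 < γ₁) (hγ₂ : 0 < γ₂) (hcl : 0 < cl) (hcu : 0 < cu) :
    -- coercivity of `B_h` for large `γ`
    (∀ δ ∈ ({-1, 0, 1} : Set ℝ), ∃ γ₀ : ℝ, ∀ γ : ℝ, γ₀ ≤ γ → ∃ Ms : ℝ, 0 < Ms ∧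
      ∀ (Ω : Set Plane) (T : Decomposition Ω)
        (S : SimplePolygon → (Plane → ℝ) → (Plane → ℝ) → ℝ),
        IsBoundedDomain Ω → T.C0 Khat → T.C1 γ₁ → T.C2 γ₂ → T.IsStab cl cu S →
        ∀ v, T.MemWDG v → Ms * T.norm1 v ^ 2 ≤ T.B S δ γ v v) ∧
    -- continuity of `ã_h` and of the jump form, and the flux-jump bound
    (∃ c : ℝ, 0 < c ∧
      ∀ (Ω : Set Plane) (T : Decomposition Ω)
        (S : SimplePolygon → (Plane → ℝ) → (Plane → ℝ) → ℝ),
        IsBoundedDomain Ω → T.C0 Khat → T.C1 γ₁ → T.C2 γ₂ → T.IsStab cl cu S →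
        (∀ v w, T.MemWDG v → T.MemWDG w → |T.aStab S w v| ≤ c * T.norm1 v * T.norm1 w) ∧
        (∀ v w, T.MemWDG v → T.MemWDG w → |T.jumpJump v w| ≤ c * T.norm1 v * T.norm1 w) ∧
        (∀ v w, T.MemH2 v → T.MemH1 w →
          |T.fluxJump T.edges v w| ≤ c * T.norm2 v * T.norm1 w)) ∧
    -- the flux-jump bound for piecewise polynomials of degree at most `l`
    (∀ l : ℕ, ∃ c : ℝ, 0 < c ∧
      ∀ (Ω : Set Plane) (T : Decomposition Ω),
        IsBoundedDomain Ω → T.C0 Khat → T.C1 γ₁ → T.C2 γ₂ →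
        ∀ v w, T.IsPiecewisePoly l v → T.MemH1 w →
          |T.fluxJump T.edges v w| ≤ c * T.norm1 v * T.norm1 w) := by
  refine ⟨fun δ hδ => ?_, ?_, fun l => ?_⟩
  · obtain ⟨C, hC, hflux⟩ := Decomposition.exists_abs_fluxJump_le Khat hγ₁ 1
    have hδ2 : |1 + δ| ≤ 2 := by
      rcases hδ with rfl | rfl | rfl <;> norm_num
    -- the first summand absorbs the flux terms, the second controls the jumps in the norm
    refine ⟨2 * C ^ 2 / min 1 cl + min 1 cl / 2, fun γ hγ => ⟨min 1 cl / 2,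
      half_pos (lt_min one_pos hcl), fun Ω T S _ h0 h1 _ hS v hv => ?_⟩⟩
    refine hv.le_B hγ₁ h1 hcl hS hδ2 ?_ hγ
    refine (hflux Ω T h0 h1 _ (Finset.filter_subset _ _) _ v (T.isPiecewisePoly_proj v)).trans ?_
    have := hv.sum_sqGrad_proj_le
    gcongr
  · set C := √(6 * (Khat.m + 3 : ℕ) / γ₁)
    have hC : 0 ≤ C := Real.sqrt_nonneg _
    refine ⟨1 + cu + C, by linarith, fun Ω T S _ h0 h1 _ hS => ⟨fun v w hv hw => ?_,
      fun v w _ _ => ?_, fun v w _ _ => ?_⟩⟩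
    · have hv0 := T.norm1_nonneg v
      have hw0 := T.norm1_nonneg w
      refine (hw.abs_aStab_le hγ₁ h1 hS hcl.le hcu.le hv).trans ?_
      rw [mul_comm √(T.energy w), ← mul_assoc]
      have hle : 1 + cu ≤ 1 + cu + C := by linarith
      gcongr
      · exact T.sqrt_energy_le_norm1 v
      · exact T.sqrt_energy_le_norm1 w
    · have hv0 := T.norm1_nonneg v
      have hw0 := T.norm1_nonneg w
      refine (T.abs_jumpJump_le v w).trans ?_
      rw [mul_assoc]
      calc _ ≤ T.norm1 v * T.norm1 w := by
            gcongr
            · exact T.sqrt_jumpJump_le_norm1 v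
            · exact T.sqrt_jumpJump_le_norm1 w
        _ ≤ _ := le_mul_of_one_le_left (by positivity) (by linarith)
    · have hv0 : 0 ≤ T.norm2 v := Real.sqrt_nonneg _
      refine (Decomposition.abs_fluxJump_le_of_shape hγ₁ h0 h1 Finset.Subset.rfl v w).trans ?_
      gcongr
      · linarith
      · exact T.sqrt_sqGrad_add_sqHess_le_norm2 v
      · exact T.sqrt_jumpJump_le_norm1 w
  · obtain ⟨C, hC, hflux⟩ := Decomposition.exists_abs_fluxJump_le Khat hγ₁ l
    refine ⟨C, hC, fun Ω T _ h0 h1 _ v w hv _ =>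
      (hflux Ω T h0 h1 _ Finset.Subset.rfl v w hv).trans ?_⟩
    have hv0 := T.norm1_nonneg v
    gcongr
    · exact T.sqrt_sqGrad_le_norm1 v
    · exact T.sqrt_jumpJump_le_norm1 w
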